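/- **Setting.** Let $\mathbb H$ be the category generated by the graph with objects $n$ and $n_t$ ($n\ge 1$) and arrows $n\to n+1$ and $n\to n_t$. A *type-and-term structure* is a presheaf $X\in[\mathbb H^{\mathrm{op}},\mathbf{Set}]$; the elements of $X(n)$ and of $X(n_t)$ are its type-elements and term-elements of degree $n$, and the restriction maps $X(n+1)\to X(n)$ and $X(n_t)\to X(n)$ are the boundary maps, all written $\partial$. For $A\in X(n)$ put $\mathrm{Tm}_X(A)=\{a\in X(n_t):\partial a=A\}$. **Theories with weakening.** A $\{w\}$-GAT is a generalised algebraic theory in Cartmell's sense whose derived judgements are generated from its basic judgements by the following rules only: reflexivity, symmetry and transitivity of type equality and of term equality; conversion of terms and of term equalities along a type equality; renaming of variables by a permutation of the set of variables; and weakening, by which $\Gamma\vdash T\ \mathsf{type}$ and $\Gamma,\Delta\vdash\mathcal J$ give $\Gamma,y:T,\Delta\vdash\mathcal J$ for $y$ not occurring in $\Gamma,\Delta$. For a $\{w\}$-GAT $\mathbb T$, let $V\mathbb T$ be the type-and-term structure whose type-elements (resp. term-elements) of degree $n$ are the derived type judgements $x_1:T_1,\dots,x_{n-1}:T_{n-1}\vdash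 T_n\ \mathsf{type}$ (resp. derived term judgements $x_1:T_1,\dots,x_{n-1}:T_{n-1}\vdash t:T_n$), taken modulo derived equality up to renaming of the variables of the context, with $\partial$ induced by forgetting the last type (resp. the term). The free $\{w\}$-GAT $GX$ on a type-and-term structure $X$ has the type-elements of $X$ as type-constants and the term-elements of $X$ as term-constants. For each $A\in X(n)$ with successive boundaries $A_{n-1},\dots,A_1$ it has the basic judgement $$x_1:A_1,\ \dots,\ x_{n-1}:A_{n-1}(x_1,\dots,x_{n-2})\vdash A(x_1,\dots,x_{n-1})\ \mathsf{type},$$ and for each $a\in\mathrm{Tm}_X(A)$ it has the basic judgement $$x_1:A_1,\ \dots,\ x_{n-1}:A_{n-1}(x_1,\dots,x_{n-2})\vdash a(x_1,\dots,x_{n-1}):A(x_1,\dots,x_{n-1}).$$ There are no other basic judgements. The underlying endofunctor of the weakening (free-$\{w\}$-GAT) monad is $W=VG$; a map $f:X\to Y$ acts by replacing each constant by its image under $f$. **Min-heaps.** A *min-heap* of size $n$ is a function $\phi:\{0,\dots,n\}\to\{0,\dots,n\}$ with $\phi(0)=0$ and $\phi(i)<i$ for $1\le i\le n$. Write $\mathrm{Hp}(n)$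 for the set of these. For $\phi\in\mathrm{Hp}(n+1)$ let $\partial\phi\in\mathrm{Hp}(n)$ be its restriction to $\{0,\dots,n\}$. The depth of $i$ is $\mathrm{dp}_\phi(i)=|\{\phi(i),\phi^2(i),\dots\}|$. Let $[\phi]\in[\mathbb H^{\mathrm{op}},\mathbf{Set}]$ have type-elements $[\phi](m)=\{i\in\{1,\dots,n\}:\mathrm{dp}_\phi(i)=m\}$, boundary maps $i\mapsto\phi(i)$, and no term-elements. For $h:[\phi]\to X$ with $\phi$ of size at least $2$, let $\partial h$ be the restriction of $h$ along the inclusion $[\partial\phi]\to[\phi]$. **Proposition.** There are bijections, natural in the type-and-term structure $X$, $$WX(n)\;\cong\;\sum_{\phi\in\mathrm{Hp}(n)}[\mathbb H^{\mathrm{op}},\mathbf{Set}]([\phi],X)\qquad(n\ge1),$$ under which the boundary map $\partial:WX(n+1)\to WX(n)$ is $(\phi,h)\mapsto(\partial\phi,\partial h)$. For each $(\phi,h)\in WX(n)$ there is a bijection, natural in $X$, $$\mathrm{Tm}_{WX}(\phi,h)\;\cong\;\mathrm{Tm}_X(h(n)).$$ -/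

import Mathlib

open CategoryTheory Opposite

universe u

/-! ### Type-and-term structures -/

/-- The vertices of the graph generating `ℍ`. The numbering is shifted by one: `ty n` is the
object `n + 1`, and `tm n` is the object `(n + 1)_t`, for `n = 0, 1, 2, …`. -/
inductive HVertex : Type
  | ty (n : ℕ)
  | tm (n : ℕ)

/-- The edges `n → n + 1` and `n → n_t`. -/
inductive HEdge : HVertex → HVertex → Type
  | succ (n : ℕ) : HEdge (.ty n) (.ty (n + 1))
  | term (n : ℕ) : HEdge (.ty n) (.tm n)

instance : Quiver HVertex := ⟨HEdge⟩

/-- The category `ℍ` generated by the graph. -/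
abbrev HCat : Type := Paths HVertex

/-- A type-and-term structure is a presheaf on `ℍ`. -/
abbrev TTStruct : Type (u + 1) := HCatᵒᵖ ⥤ Type u

namespace TTStruct

/-- The object `n + 1` of `ℍ`. -/
abbrev tyObj (n : ℕ) : HCat := (Paths.of HVertex).obj (.ty n)

/-- The object `(n + 1)_t` of `ℍ`. -/
abbrev tmObj (n : ℕ) : HCat := (Paths.of HVertex).obj (.tm n)

/-- Type-elements of degree `n + 1`. -/
abbrev Ty (X : TTStruct.{u}) (n : ℕ) : Type u := X.obj (op (tyObj n))

/-- Term-elements of degree `n + 1`. -/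
abbrev TmEl (X : TTStruct.{u}) (n : ℕ) : Type u := X.obj (op (tmObj n))

/-- The boundary map from type-elements of degree `n + 2` to those of degree `n + 1`. -/
def bd (X : TTStruct.{u}) {n : ℕ} (A : X.Ty (n + 1)) : X.Ty n :=
  X.map ((Paths.of HVertex).map (HEdge.succ n)).op A

/-- The boundary map from term-elements of degree `n + 1` to type-elements of that degree. -/
def tmBd (X : TTStruct.{u}) {n : ℕ} (a : X.TmEl n) : X.Ty n :=
  X.map ((Paths.of HVertex).map (HEdge.term n)).op a

/-- `Tm_X(A)`: the term-elements of `X` with boundary `A`. -/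
def Tm (X : TTStruct.{u}) {n : ℕ} (A : X.Ty n) : Type u := { a : X.TmEl n // X.tmBd a = A }

/-- The action of a map of type-and-term structures on type-elements. -/
def mapTy {X Y : TTStruct.{u}} (f : X ⟶ Y) {n : ℕ} (A : X.Ty n) : Y.Ty n :=
  f.app (op (tyObj n)) A

/-- The action of a map of type-and-term structures on term-elements. -/
def mapTmEl {X Y : TTStruct.{u}} (f : X ⟶ Y) {n : ℕ} (a : X.TmEl n) : Y.TmEl n :=
  f.app (op (tmObj n)) a

theorem mapTy_bd {X Y : TTStruct.{u}} (f : X ⟶ Y) {n : ℕ} (A : X.Ty (n + 1)) :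
    mapTy f (X.bd A) = Y.bd (mapTy f A) :=
  NatTrans.naturality_apply f ((Paths.of HVertex).map (HEdge.succ n)).op A

theorem mapTy_tmBd {X Y : TTStruct.{u}} (f : X ⟶ Y) {n : ℕ} (a : X.TmEl n) :
    mapTy f (X.tmBd a) = Y.tmBd (mapTmEl f a) :=
  NatTrans.naturality_apply f ((Paths.of HVertex).map (HEdge.term n)).op a

/-- The map `Tm_X(A) → Tm_Y(f(A))` induced by `f : X ⟶ Y`. -/
def mapTm {X Y : TTStruct.{u}} (f : X ⟶ Y) {n : ℕ} {A : X.Ty n} (a : X.Tm A) :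
    Y.Tm (mapTy f A) :=
  ⟨mapTmEl f a.1, by rw [← mapTy_tmBd, a.2]⟩

section Build

variable (A B : ℕ → Type u) (p : ∀ n, A (n + 1) → A n) (q : ∀ n, B n → A n)

/-- The underlying map of graphs of `TTStruct.mk`. -/
def mkPre : HVertex ⥤q (Type u)ᵒᵖ where
  obj
    | .ty n => op (A n)
    | .tm n => op (B n)
  map
    | .succ n => (TypeCat.ofHom (p n)).op
    | .term n => (TypeCat.ofHom (q n)).op

/-- The type-and-term structure with type-elements `A`, term-elements `B` and boundary maps
`p` and `q`. -/
def mk : TTStruct.{u} := (Paths.lift (mkPre A B p q)).leftOp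

theorem bd_mk {n : ℕ} (a : (mk A B p q).Ty (n + 1)) : (mk A B p q).bd a = p n a := rfl

theorem tmBd_mk {n : ℕ} (b : (mk A B p q).TmEl n) : (mk A B p q).tmBd b = q n b := rfl

end Build

/-- A map of type-and-term structures is given by maps on type- and term-elements which commute
with the boundary maps. -/
def homMk {X Y : TTStruct.{u}} (f : ∀ n, X.Ty n → Y.Ty n) (g : ∀ n, X.TmEl n → Y.TmEl n)
    (hf : ∀ n (A : X.Ty (n + 1)), f n (X.bd A) = Y.bd (f (n + 1) A))
    (hg : ∀ n (a : X.TmEl n), f n (X.tmBd a) = Y.tmBd (g n a)) : X ⟶ Y where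
  app
    | ⟨.ty n⟩ => TypeCat.ofHom (f n)
    | ⟨.tm n⟩ => TypeCat.ofHom (g n)
  naturality := by
    suffices h : ∀ (a b : HCat) (k : a ⟶ b),
        X.map k.op ≫ (match (op a : HCatᵒᵖ) with
          | ⟨.ty n⟩ => TypeCat.ofHom (f n)
          | ⟨.tm n⟩ => TypeCat.ofHom (g n) : X.obj (op a) ⟶ Y.obj (op a)) =
        (match (op b : HCatᵒᵖ) with
          | ⟨.ty n⟩ => TypeCat.ofHom (f n)
          | ⟨.tm n⟩ => TypeCat.ofHom (g n) : X.obj (op b) ⟶ Y.obj (op b)) ≫ Y.map k.op from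
      fun a b k => h b.unop a.unop k.unop
    intro a b k
    refine Paths.induction (V := HVertex) (P := fun {a b} k =>
        X.map k.op ≫ (match (op a : HCatᵒᵖ) with
          | ⟨.ty n⟩ => TypeCat.ofHom (f n)
          | ⟨.tm n⟩ => TypeCat.ofHom (g n) : X.obj (op a) ⟶ Y.obj (op a)) =
        (match (op b : HCatᵒᵖ) with
          | ⟨.ty n⟩ => TypeCat.ofHom (f n)
          | ⟨.tm n⟩ => TypeCat.ofHom (g n) : X.obj (op b) ⟶ Y.obj (op b)) ≫ Y.map k.op)
        ?_ ?_ k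
    · intro v
      rw [op_id, X.map_id, Y.map_id, Category.id_comp, Category.comp_id]
    · intro u v w p e ih
      rw [op_comp, X.map_comp, Y.map_comp, Category.assoc, ih, ← Category.assoc,
        ← Category.assoc]
      congr 1
      change HEdge v w at e
      cases e with
      | succ n => ext A; exact hf n A
      | term n => ext a; exact hg n a

theorem mapTy_homMk {X Y : TTStruct.{u}} (f : ∀ n, X.Ty n → Y.Ty n)
    (g : ∀ n, X.TmEl n → Y.TmEl n) (hf hg) {n : ℕ} (A : X.Ty n) :
    mapTy (homMk f g hf hg) A = f n A := rfl

theorem mapTmEl_homMk {X Y : TTStruct.{u}} (f : ∀ n, X.Ty n → Y.Ty n)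
    (g : ∀ n, X.TmEl n → Y.TmEl n) (hf hg) {n : ℕ} (a : X.TmEl n) :
    mapTmEl (homMk f g hf hg) a = g n a := rfl

theorem hom_ext {X Y : TTStruct.{u}} {f g : X ⟶ Y}
    (h : ∀ n (A : X.Ty n), mapTy f A = mapTy g A)
    (h' : ∀ n (a : X.TmEl n), mapTmEl f a = mapTmEl g a) : f = g := by
  ext ⟨v⟩ x
  cases v with
  | ty n => exact h n x
  | tm n => exact h' n x

end TTStruct

/-! ### Min-heaps -/

/-- A min-heap of size `n`: a function `φ : [0,n] → [0,n]` with `φ 0 = 0` and `φ i < i` for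
`i ∈ [n]`. -/
@[ext] structure MinHeap (n : ℕ) where
  toFun : Fin (n + 1) → Fin (n + 1)
  map_zero : toFun 0 = 0
  map_lt : ∀ i, i ≠ 0 → toFun i < i

namespace MinHeap

/-- The restriction `∂φ` of a min-heap of size `n + 1` to `[0,n]`. -/
def bd {n : ℕ} (φ : MinHeap (n + 1)) : MinHeap n where
  toFun i := ⟨φ.toFun i.castSucc, by
    by_cases h : i = 0
    · subst h
      rw [Fin.castSucc_zero, φ.map_zero]
      simp
    · exact lt_trans (φ.map_lt i.castSucc (fun h' => h (Fin.castSucc_injective _ h'))) i.2⟩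
  map_zero := by
    apply Fin.ext
    simp [Fin.castSucc_zero, φ.map_zero]
  map_lt i h := φ.map_lt i.castSucc (fun h' => h (Fin.castSucc_injective _ h'))

/-- The depth of `i`: the cardinality of `{φ i, φ² i, …}`. -/
noncomputable def depth {n : ℕ} (φ : MinHeap n) (i : Fin (n + 1)) : ℕ :=
  Set.ncard { j | ∃ k, 1 ≤ k ∧ φ.toFun^[k] i = j }

theorem iterate_zero {n : ℕ} (φ : MinHeap n) (k : ℕ) : φ.toFun^[k] 0 = 0 :=
  Function.iterate_fixed φ.map_zero k

theorem depth_root {n : ℕ} (φ : MinHeap n) {i : Fin (n + 1)} (h : φ.toFun i = 0) :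
    φ.depth i = 1 := by
  have : { j | ∃ k, 1 ≤ k ∧ φ.toFun^[k] i = j } = {0} := by
    ext j
    constructor
    · rintro ⟨k, hk, rfl⟩
      obtain ⟨k, rfl⟩ := Nat.exists_eq_add_of_le' hk
      rw [Function.iterate_succ_apply, h, iterate_zero]
      rfl
    · rintro rfl
      exact ⟨1, le_rfl, h⟩
  rw [depth, this, Set.ncard_singleton]

theorem iterate_lt {n : ℕ} (φ : MinHeap n) {i : Fin (n + 1)} (h : i ≠ 0) {k : ℕ} (hk : 1 ≤ k) :
    φ.toFun^[k] i < i := by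
  induction k, hk using Nat.le_induction with
  | base => exact φ.map_lt i h
  | succ k _ ih =>
    rw [Function.iterate_succ_apply']
    by_cases h0 : φ.toFun^[k] i = 0
    · rw [h0, φ.map_zero]
      exact Fin.pos_of_ne_zero h
    · exact lt_trans (φ.map_lt _ h0) ih

theorem depth_step {n : ℕ} (φ : MinHeap n) {i : Fin (n + 1)} (h : φ.toFun i ≠ 0) :
    φ.depth i = φ.depth (φ.toFun i) + 1 := by
  have key : { j | ∃ k, 1 ≤ k ∧ φ.toFun^[k] i = j } =
      insert (φ.toFun i) { j | ∃ k, 1 ≤ k ∧ φ.toFun^[k] (φ.toFun i) = j } := by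
    ext j
    constructor
    · rintro ⟨k, hk, rfl⟩
      obtain ⟨k, rfl⟩ := Nat.exists_eq_add_of_le' hk
      rcases Nat.eq_zero_or_pos k with rfl | hk'
      · exact Or.inl rfl
      · exact Or.inr ⟨k, hk', rfl⟩
    · rintro (rfl | ⟨k, hk, rfl⟩)
      · exact ⟨1, le_rfl, rfl⟩
      · exact ⟨k + 1, by omega, rfl⟩
  rw [depth, key, Set.ncard_insert_of_notMem _ (Set.toFinite _)]
  · rfl
  · rintro ⟨k, hk, e⟩
    exact absurd (φ.iterate_lt h hk) (by rw [e]; exact lt_irrefl _)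

theorem depth_pos {n : ℕ} (φ : MinHeap n) (i : Fin (n + 1)) : 0 < φ.depth i :=
  (Set.ncard_pos (Set.toFinite _)).2 ⟨_, 1, le_rfl, rfl⟩

theorem iterate_bd {n : ℕ} (φ : MinHeap (n + 1)) (i : Fin (n + 1)) (k : ℕ) :
    (φ.bd.toFun^[k] i).castSucc = φ.toFun^[k] i.castSucc := by
  induction k with
  | zero => rfl
  | succ k ih =>
    rw [Function.iterate_succ_apply', Function.iterate_succ_apply', ← ih]
    rfl

theorem depth_bd {n : ℕ} (φ : MinHeap (n + 1)) (i : Fin (n + 1)) :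
    φ.depth i.castSucc = φ.bd.depth i := by
  rw [depth, depth, ← Set.ncard_image_of_injective _ (Fin.castSucc_injective (n + 1))]
  congr 1
  ext j
  constructor
  · rintro ⟨k, hk, rfl⟩
    exact ⟨_, ⟨k, hk, rfl⟩, iterate_bd φ i k⟩
  · rintro ⟨_, ⟨k, hk, rfl⟩, rfl⟩
    exact ⟨k, hk, (iterate_bd φ i k).symm⟩

/-- The type-elements of degree `m + 1` of `[φ]`: those `i ∈ [n]` of depth `m + 1`. -/
def ShapeTy {n : ℕ} (φ : MinHeap n) (m : ℕ) : Type u :=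
  ULift.{u} { i : Fin (n + 1) // i ≠ 0 ∧ φ.depth i = m + 1 }

/-- The boundary map `i ↦ φ i` of `[φ]`. -/
def shapeBd {n : ℕ} (φ : MinHeap n) (m : ℕ) (i : ShapeTy.{u} φ (m + 1)) : ShapeTy.{u} φ m :=
  ⟨φ.toFun i.down.1, by
    have h : φ.toFun i.down.1 ≠ 0 := by
      intro h0
      have := φ.depth_root h0
      have := i.down.2.2
      omega
    have := φ.depth_step h
    have := i.down.2.2
    exact ⟨h, by omega⟩⟩

/-- The presheaf `[φ]` encoding a type judgement of shape `φ`; it has no term-elements. -/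
def shape {n : ℕ} (φ : MinHeap n) : TTStruct.{u} :=
  TTStruct.mk (ShapeTy φ) (fun _ => PEmpty) (shapeBd φ) (fun _ => PEmpty.elim)

/-- The inclusion `[∂φ] ⟶ [φ]`. -/
def shapeIncl {n : ℕ} (φ : MinHeap (n + 1)) : shape.{u} φ.bd ⟶ shape.{u} φ :=
  TTStruct.homMk
    (fun _ i => ⟨i.down.1.castSucc, fun h => i.down.2.1 (Fin.castSucc_injective _ h),
      (φ.depth_bd _).trans i.down.2.2⟩)
    (fun _ a => PEmpty.elim a) (fun _ _ => rfl) (fun _ a => PEmpty.elim a)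

end MinHeap

/-- The pairs `(φ, h)` with `φ ∈ Hp(n + 1)` and `h : [φ] ⟶ X`. -/
abbrev HeapTy (X : TTStruct.{u}) (n : ℕ) : Type u :=
  Σ φ : MinHeap (n + 1), (MinHeap.shape.{u} φ ⟶ X)

namespace HeapTy

/-- `∂(φ, h) = (∂φ, ∂h)`, with `∂h` the restriction of `h` to `[∂φ]`. -/
def bd {X : TTStruct.{u}} {n : ℕ} (p : HeapTy X (n + 1)) : HeapTy X n :=
  ⟨p.1.bd, MinHeap.shapeIncl p.1 ≫ p.2⟩

/-- Postcomposition with `f : X ⟶ Y`. -/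
def map {X Y : TTStruct.{u}} (f : X ⟶ Y) {n : ℕ} (p : HeapTy X n) : HeapTy Y n :=
  ⟨p.1, p.2 ≫ f⟩

/-- The degree (less one) of `h(i)`, where `i` is the largest element of `φ`. -/
noncomputable def topDeg {X : TTStruct.{u}} {n : ℕ} (p : HeapTy X n) : ℕ :=
  p.1.depth (Fin.last (n + 1)) - 1

/-- The largest element of `φ`, as a type-element of `[φ]`. -/
noncomputable def lastEl {n : ℕ} (φ : MinHeap (n + 1)) :
    (MinHeap.shape.{u} φ).Ty (φ.depth (Fin.last (n + 1)) - 1) :=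
  (⟨Fin.last (n + 1), Fin.last_pos.ne', (Nat.sub_add_cancel (φ.depth_pos _)).symm⟩ :
    MinHeap.ShapeTy.{u} φ (φ.depth (Fin.last (n + 1)) - 1))

/-- For `(φ, h)` with `φ` of size `N`, the type-element `h(N)` of `X`. -/
noncomputable def top {X : TTStruct.{u}} {n : ℕ} (p : HeapTy X n) : X.Ty p.topDeg :=
  TTStruct.mapTy p.2 (lastEl p.1)

theorem top_map {X Y : TTStruct.{u}} (f : X ⟶ Y) {n : ℕ} (p : HeapTy X n) :
    (p.map f).top = TTStruct.mapTy f p.top := rfl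

end HeapTy

/-! ### Syntax -/

/-- Expressions over an alphabet `K`, with variables in `ℕ`. -/
inductive Expr (K : Type u) : Type u
  | var (x : ℕ)
  | app (w : K) {n : ℕ} (args : Fin n → Expr K)

namespace Expr

variable {K L : Type u}

/-- The free variables of an expression. -/
def fv : Expr K → Set ℕ
  | var x => {x}
  | app _ args => ⋃ i, (args i).fv

/-- Simultaneous replacement of each variable `x` by the variable `f x`. -/
def rename (f : ℕ → ℕ) : Expr K → Expr K
  | var x => var (f x)
  | app w args => app w fun i => (args i).rename f

/-- Replacement of each constant `w` by the constant `g w`. -/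
def mapConst (g : K → L) : Expr K → Expr L
  | var x => var x
  | app w args => app (g w) fun i => (args i).mapConst g

/-- The expression `w(x₁, …, xₖ)`, where `l = [x₁, …, xₖ]`. -/
def appVars (w : K) (l : List ℕ) : Expr K := app w fun i : Fin l.length => var (l.get i)

theorem fv_mapConst (g : K → L) (e : Expr K) : (e.mapConst g).fv = e.fv := by
  induction e with
  | var x => rfl
  | app w args ih => simp only [mapConst, fv, ih]

theorem rename_mapConst (g : K → L) (f : ℕ → ℕ) (e : Expr K) :
    (e.rename f).mapConst g = (e.mapConst g).rename f := by
  induction e with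
  | var x => rfl
  | app w args ih => simp only [mapConst, rename, ih]

theorem mapConst_id (e : Expr K) : e.mapConst id = e := by
  induction e with
  | var x => rfl
  | app w args ih => simp only [mapConst, ih, id]

theorem mapConst_comp {M : Type u} (g : K → L) (k : L → M) (e : Expr K) :
    e.mapConst (k ∘ g) = (e.mapConst g).mapConst k := by
  induction e with
  | var x => rfl
  | app w args ih => simp only [mapConst, ih, Function.comp]

theorem mapConst_appVars (g : K → L) (w : K) (l : List ℕ) :
    (appVars w l).mapConst g = appVars (g w) l := rfl

end Expr

/-- A context `x₁ : T₁, …, xₙ : Tₙ`, stored as a list with the LAST declaration first: the list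
`(x, T) :: Γ` stands for `Γ, x : T`, and `Δ ++ Γ` for `Γ, Δ`. Distinctness of the variables is
required separately. -/
abbrev Ctx (K : Type u) : Type u := List (ℕ × Expr K)

namespace Ctx

variable {K L : Type u}

/-- The declared variables `x₁, …, xₙ`, in this order. -/
def vars (Γ : Ctx K) : List ℕ := (List.map Prod.fst Γ).reverse

/-- The variables which occur in a context, either as declared variables or in the types. -/
def fv (Γ : Ctx K) : Set ℕ := { y | ∃ d ∈ Γ, y = d.1 ∨ y ∈ d.2.fv }

def rename (f : ℕ → ℕ) (Γ : Ctx K) : Ctx K := List.map (fun d => (f d.1, d.2.rename f)) Γ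

def mapConst (g : K → L) (Γ : Ctx K) : Ctx L := List.map (fun d => (d.1, d.2.mapConst g)) Γ

/-- The renaming `[x₁/y₁, …, xₙ/yₙ]`, where `Γ` declares `x₁, …, xₙ` and `Δ` declares
`y₁, …, yₙ`. Other variables are fixed. -/
def varSubst : Ctx K → Ctx K → ℕ → ℕ
  | (x, _) :: Γ, (y, _) :: Δ, v => if v = y then x else varSubst Γ Δ v
  | _, _, v => v

theorem fv_mapConst (g : K → L) (Γ : Ctx K) : (mapConst g Γ).fv = fv Γ := by
  ext y
  simp only [fv, mapConst, Set.mem_ofPred_eq, List.mem_map]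
  constructor
  · rintro ⟨_, ⟨d, hd, rfl⟩, h⟩
    exact ⟨d, hd, by rwa [Expr.fv_mapConst] at h⟩
  · rintro ⟨d, hd, h⟩
    exact ⟨_, ⟨d, hd, rfl⟩, by rwa [Expr.fv_mapConst]⟩

theorem mapConst_id (Γ : Ctx K) : mapConst id Γ = Γ := by
  simp [mapConst, Expr.mapConst_id]

theorem mapConst_comp {M : Type u} (g : K → L) (k : L → M) (Γ : Ctx K) :
    mapConst (k ∘ g) Γ = mapConst k (mapConst g Γ) := by
  simp [mapConst, Expr.mapConst_comp]

theorem varSubst_mapConst (g : K → L) :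
    ∀ Γ Δ : Ctx K, varSubst (mapConst g Γ) (mapConst g Δ) = varSubst Γ Δ
  | [], _ => by funext v; simp [mapConst, varSubst]
  | _ :: _, [] => by funext v; simp [mapConst, varSubst]
  | (x, S) :: Γ, (y, T) :: Δ => by
    funext v
    have := congrFun (varSubst_mapConst g Γ Δ) v
    simp only [mapConst] at this
    simp only [mapConst, List.map_cons, varSubst, this]

end Ctx

/-- What a judgement asserts in its context: `T type`, `t : T`, `T = T' type` or `t = t' : T`. -/
inductive Assertion (K : Type u) : Type u
  | type (T : Expr K)
  | term (t T : Expr K)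
  | typeEq (T T' : Expr K)
  | termEq (t t' T : Expr K)

namespace Assertion

variable {K L : Type u}

def rename (f : ℕ → ℕ) : Assertion K → Assertion K
  | type T => type (T.rename f)
  | term t T => term (t.rename f) (T.rename f)
  | typeEq T T' => typeEq (T.rename f) (T'.rename f)
  | termEq t t' T => termEq (t.rename f) (t'.rename f) (T.rename f)

def mapConst (g : K → L) : Assertion K → Assertion L
  | type T => type (T.mapConst g)
  | term t T => term (t.mapConst g) (T.mapConst g)
  | typeEq T T' => typeEq (T.mapConst g) (T'.mapConst g)
  | termEq t t' T => termEq (t.mapConst g) (t'.mapConst g) (T.mapConst g)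

end Assertion

/-- A judgement `Γ ⊢ 𝒥`. -/
structure Judgement (K : Type u) : Type u where
  ctx : Ctx K
  concl : Assertion K

namespace Judgement

variable {K L : Type u}

def rename (f : ℕ → ℕ) (J : Judgement K) : Judgement K := ⟨J.ctx.rename f, J.concl.rename f⟩

def mapConst (g : K → L) (J : Judgement K) : Judgement L :=
  ⟨J.ctx.mapConst g, J.concl.mapConst g⟩

/-- The boundary of a judgement, a list of judgements of length `0`, `1` or `2`. -/
def boundary : Judgement K → List (Judgement K)
  | ⟨[], .type _⟩ => []
  | ⟨(_, T) :: Γ, .type _⟩ => [⟨Γ, .type T⟩]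
  | ⟨Γ, .term _ T⟩ => [⟨Γ, .type T⟩]
  | ⟨Γ, .typeEq T T'⟩ => [⟨Γ, .type T⟩, ⟨Γ, .type T'⟩]
  | ⟨Γ, .termEq t t' T⟩ => [⟨Γ, .term t T⟩, ⟨Γ, .term t' T⟩]

theorem boundary_mapConst (g : K → L) (J : Judgement K) :
    (J.mapConst g).boundary = J.boundary.map (mapConst g) := by
  obtain ⟨Γ, 𝒥⟩ := J
  cases 𝒥 <;> cases Γ <;> rfl

end Judgement

/-! ### Theories with the weakening rule -/

/-- The judgements derived from the collection `Λ` of basic judgements: the smallest collection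
closed under the equality rules, the `α` rule and the weakening rule, and which contains a member
of `Λ` whenever it contains each judgement in its boundary. -/
inductive Derivable {K : Type u} (Λ : Set (Judgement K)) : Judgement K → Prop
  | basic {J : Judgement K} : J ∈ Λ → (∀ B ∈ J.boundary, Derivable Λ B) → Derivable Λ J
  | termRefl {Γ : Ctx K} {t T : Expr K} : Derivable Λ ⟨Γ, .term t T⟩ →
      Derivable Λ ⟨Γ, .termEq t t T⟩
  | termSymm {Γ : Ctx K} {t₁ t₂ T : Expr K} : Derivable Λ ⟨Γ, .termEq t₁ t₂ T⟩ →
      Derivable Λ ⟨Γ, .termEq t₂ t₁ T⟩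
  | termTrans {Γ : Ctx K} {t₁ t₂ t₃ T : Expr K} : Derivable Λ ⟨Γ, .termEq t₁ t₂ T⟩ →
      Derivable Λ ⟨Γ, .termEq t₂ t₃ T⟩ → Derivable Λ ⟨Γ, .termEq t₁ t₃ T⟩
  | typeRefl {Γ : Ctx K} {T : Expr K} : Derivable Λ ⟨Γ, .type T⟩ → Derivable Λ ⟨Γ, .typeEq T T⟩
  | typeSymm {Γ : Ctx K} {T₁ T₂ : Expr K} : Derivable Λ ⟨Γ, .typeEq T₁ T₂⟩ →
      Derivable Λ ⟨Γ, .typeEq T₂ T₁⟩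
  | typeTrans {Γ : Ctx K} {T₁ T₂ T₃ : Expr K} : Derivable Λ ⟨Γ, .typeEq T₁ T₂⟩ →
      Derivable Λ ⟨Γ, .typeEq T₂ T₃⟩ → Derivable Λ ⟨Γ, .typeEq T₁ T₃⟩
  | termConv {Γ : Ctx K} {t T₁ T₂ : Expr K} : Derivable Λ ⟨Γ, .typeEq T₁ T₂⟩ →
      Derivable Λ ⟨Γ, .term t T₁⟩ → Derivable Λ ⟨Γ, .term t T₂⟩
  | termEqConv {Γ : Ctx K} {t₁ t₂ T₁ T₂ : Expr K} : Derivable Λ ⟨Γ, .typeEq T₁ T₂⟩ →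
      Derivable Λ ⟨Γ, .termEq t₁ t₂ T₁⟩ → Derivable Λ ⟨Γ, .termEq t₁ t₂ T₂⟩
  | alpha {J : Judgement K} (σ : Equiv.Perm ℕ) : Derivable Λ J → Derivable Λ (J.rename σ)
  | weaken {Γ Δ : Ctx K} {y : ℕ} {T : Expr K} {𝒥 : Assertion K} : Derivable Λ ⟨Γ, .type T⟩ →
      Derivable Λ ⟨Δ ++ Γ, 𝒥⟩ → y ∉ Γ.fv → y ∉ Δ.fv → Derivable Λ ⟨Δ ++ (y, T) :: Γ, 𝒥⟩

namespace Derivable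

variable {K L : Type u} {Λ : Set (Judgement K)}

theorem mapConst {Λ' : Set (Judgement L)} (g : K → L) (hg : ∀ J ∈ Λ, J.mapConst g ∈ Λ')
    {J : Judgement K} (h : Derivable Λ J) : Derivable Λ' (J.mapConst g) := by
  induction h with
  | @basic J hJ _ ih =>
    refine .basic (hg J hJ) ?_
    rw [Judgement.boundary_mapConst]
    intro B hB
    obtain ⟨B, hB, rfl⟩ := List.mem_map.1 hB
    exact ih B ‹_›
  | termRefl _ ih => exact .termRefl ih
  | termSymm _ ih => exact .termSymm ih
  | termTrans _ _ ih₁ ih₂ => exact .termTrans ih₁ ih₂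
  | typeRefl _ ih => exact .typeRefl ih
  | typeSymm _ ih => exact .typeSymm ih
  | typeTrans _ _ ih₁ ih₂ => exact .typeTrans ih₁ ih₂
  | termConv _ _ ih₁ ih₂ => exact .termConv ih₁ ih₂
  | termEqConv _ _ ih₁ ih₂ => exact .termEqConv ih₁ ih₂
  | @alpha J σ _ ih =>
    have : (J.rename σ).mapConst g = (J.mapConst g).rename σ := by
      obtain ⟨Γ, 𝒥⟩ := J
      cases 𝒥 <;>
        simp [Judgement.rename, Judgement.mapConst, Ctx.rename, Ctx.mapConst, Assertion.rename,
          Assertion.mapConst, Expr.rename_mapConst]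
    rw [this]
    exact .alpha σ ih
  | @weaken Γ Δ y T 𝒥 _ _ hΓ hΔ ih₁ ih₂ =>
    have e₂ : Judgement.mapConst g ⟨Δ ++ Γ, 𝒥⟩ =
        ⟨Δ.mapConst g ++ Γ.mapConst g, 𝒥.mapConst g⟩ := by
      simp [Judgement.mapConst, Ctx.mapConst]
    have e₃ : Judgement.mapConst g ⟨Δ ++ (y, T) :: Γ, 𝒥⟩ =
        ⟨Δ.mapConst g ++ (y, T.mapConst g) :: Γ.mapConst g, 𝒥.mapConst g⟩ := by
      simp [Judgement.mapConst, Ctx.mapConst]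
    rw [e₂] at ih₂
    rw [e₃]
    exact .weaken ih₁ ih₂ (by rwa [Ctx.fv_mapConst]) (by rwa [Ctx.fv_mapConst])

/-- Auxiliary form of the fact that boundaries of derivable judgements are derivable. -/
theorem presup {J : Judgement K} (h : Derivable Λ J) :
    (∀ x T Γ, J.ctx = (x, T) :: Γ → Derivable Λ ⟨Γ, .type T⟩) ∧
    (∀ t T, J.concl = .term t T → Derivable Λ ⟨J.ctx, .type T⟩) ∧
    (∀ T T', J.concl = .typeEq T T' →
      Derivable Λ ⟨J.ctx, .type T⟩ ∧ Derivable Λ ⟨J.ctx, .type T'⟩) := by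
  induction h with
  | @basic J _ hB ih =>
    obtain ⟨Γ, 𝒥⟩ := J
    cases 𝒥 with
    | type T =>
      refine ⟨?_, by simp, by simp⟩
      rintro x S Γ' rfl
      exact hB _ (by simp [Judgement.boundary])
    | term t T =>
      have hm : (⟨Γ, .type T⟩ : Judgement K) ∈ Judgement.boundary ⟨Γ, .term t T⟩ := by
        cases Γ <;> simp [Judgement.boundary]
      refine ⟨(ih _ hm).1, ?_, by simp⟩
      rintro _ _ ⟨⟩
      exact hB _ hm
    | typeEq T T' =>
      have hm : (⟨Γ, .type T⟩ : Judgement K) ∈ Judgement.boundary ⟨Γ, .typeEq T T'⟩ := by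
        cases Γ <;> simp [Judgement.boundary]
      have hm' : (⟨Γ, .type T'⟩ : Judgement K) ∈ Judgement.boundary ⟨Γ, .typeEq T T'⟩ := by
        cases Γ <;> simp [Judgement.boundary]
      refine ⟨(ih _ hm).1, by simp, ?_⟩
      rintro _ _ ⟨⟩
      exact ⟨hB _ hm, hB _ hm'⟩
    | termEq t t' T =>
      have hm : (⟨Γ, .term t T⟩ : Judgement K) ∈ Judgement.boundary ⟨Γ, .termEq t t' T⟩ := by
        cases Γ <;> simp [Judgement.boundary]
      exact ⟨(ih _ hm).1, by simp, by simp⟩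
  | termRefl _ ih => exact ⟨ih.1, by simp, by simp⟩
  | termSymm _ ih => exact ⟨ih.1, by simp, by simp⟩
  | termTrans _ _ ih₁ _ => exact ⟨ih₁.1, by simp, by simp⟩
  | typeRefl h ih =>
    refine ⟨ih.1, by simp, ?_⟩
    rintro _ _ ⟨⟩
    exact ⟨h, h⟩
  | typeSymm _ ih =>
    refine ⟨ih.1, by simp, ?_⟩
    rintro _ _ ⟨⟩
    exact (ih.2.2 _ _ rfl).symm
  | typeTrans _ _ ih₁ ih₂ =>
    refine ⟨ih₁.1, by simp, ?_⟩
    rintro _ _ ⟨⟩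
    exact ⟨(ih₁.2.2 _ _ rfl).1, (ih₂.2.2 _ _ rfl).2⟩
  | termConv _ _ ih₁ _ =>
    refine ⟨ih₁.1, ?_, by simp⟩
    rintro _ _ ⟨⟩
    exact (ih₁.2.2 _ _ rfl).2
  | termEqConv _ _ ih₁ _ => exact ⟨ih₁.1, by simp, by simp⟩
  | @alpha J σ _ ih =>
    obtain ⟨Γ, 𝒥⟩ := J
    refine ⟨?_, ?_, ?_⟩
    · intro x T Γ' e
      cases Γ with
      | nil => simp [Judgement.rename, Ctx.rename] at e
      | cons d Γ =>
        obtain ⟨x₀, T₀⟩ := d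
        simp only [Judgement.rename, Ctx.rename, List.map_cons, List.cons.injEq,
          Prod.mk.injEq] at e
        obtain ⟨⟨rfl, rfl⟩, rfl⟩ := e
        exact .alpha σ (ih.1 x₀ T₀ Γ rfl)
    · intro t T e
      cases 𝒥 <;> simp only [Judgement.rename, Assertion.rename, reduceCtorEq,
        Assertion.term.injEq] at e
      obtain ⟨rfl, rfl⟩ := e
      exact .alpha σ (ih.2.1 _ _ rfl)
    · intro T T' e
      cases 𝒥 <;> simp only [Judgement.rename, Assertion.rename, reduceCtorEq,
        Assertion.typeEq.injEq] at e
      obtain ⟨rfl, rfl⟩ := e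
      exact ⟨.alpha σ (ih.2.2 _ _ rfl).1, .alpha σ (ih.2.2 _ _ rfl).2⟩
  | @weaken Γ Δ y T 𝒥 hT _ hΓ hΔ _ ih =>
    refine ⟨?_, ?_, ?_⟩
    · intro x S Γ' e
      cases Δ with
      | nil =>
        simp only [List.nil_append, List.cons.injEq, Prod.mk.injEq] at e
        obtain ⟨⟨rfl, rfl⟩, rfl⟩ := e
        exact hT
      | cons d Δ =>
        simp only [List.cons_append, List.cons.injEq] at e
        obtain ⟨rfl, rfl⟩ := e
        refine .weaken hT (ih.1 _ _ _ rfl) hΓ ?_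
        rintro ⟨d, hd, h⟩
        exact hΔ ⟨d, List.mem_cons_of_mem _ hd, h⟩
    · intro t S e
      exact .weaken hT (ih.2.1 t S e) hΓ hΔ
    · intro S S' e
      exact ⟨.weaken hT (ih.2.2 S S' e).1 hΓ hΔ, .weaken hT (ih.2.2 S S' e).2 hΓ hΔ⟩

theorem ctx_tail {x : ℕ} {T : Expr K} {Γ : Ctx K} {𝒥 : Assertion K}
    (h : Derivable Λ ⟨(x, T) :: Γ, 𝒥⟩) : Derivable Λ ⟨Γ, .type T⟩ :=
  h.presup.1 x T Γ rfl

theorem term_type {Γ : Ctx K} {t T : Expr K} (h : Derivable Λ ⟨Γ, .term t T⟩) :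
    Derivable Λ ⟨Γ, .type T⟩ :=
  h.presup.2.1 t T rfl

end Derivable

/-- The judgement is of the form `x₁ : T₁, …, xₖ : Tₖ ⊢ A(x₁, …, xₖ) type`. -/
def Judgement.Introduces {K : Type u} (A : K) (J : Judgement K) : Prop :=
  J.concl = .type (Expr.appVars A J.ctx.vars)

/-- The judgement is of the form `x₁ : T₁, …, xₖ : Tₖ ⊢ f(x₁, …, xₖ) : T`. -/
def Judgement.IntroducesTerm {K : Type u} (f : K) (J : Judgement K) : Prop :=
  ∃ T, J.concl = .term (Expr.appVars f J.ctx.vars) T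

/-- The judgement is a type equality or term equality judgement. -/
def Judgement.IsEquality {K : Type u} (J : Judgement K) : Prop :=
  (∃ T T', J.concl = .typeEq T T') ∨ ∃ t t' T, J.concl = .termEq t t' T

/-- A `{w}`-GAT: a generalised algebraic theory in which, of the structural rules, only weakening
is available. -/
structure WGAT : Type (u + 1) where
  TyConst : Type u
  TmConst : Type u
  basic : Set (Judgement (TyConst ⊕ TmConst))
  vars_nodup : ∀ J ∈ basic, J.ctx.vars.Nodup
  tyConst_unique : ∀ A : TyConst, ∃! J, J ∈ basic ∧ J.Introduces (.inl A)
  tmConst_unique : ∀ f : TmConst, ∃! J, J ∈ basic ∧ J.IntroducesTerm (.inr f)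
  basic_form : ∀ J ∈ basic, (∃ A, J.Introduces (.inl A)) ∨ (∃ f, J.IntroducesTerm (.inr f)) ∨
    J.IsEquality
  basic_derivable : ∀ J ∈ basic, Derivable basic J

/-! ### The underlying type-and-term structure of a theory -/

section Underlying

variable {K : Type u} (Λ : Set (Judgement K))

/-- A derived type judgement of degree `n + 1`. -/
@[ext] structure TyJ (n : ℕ) : Type u where
  ctx : Ctx K
  ty : Expr K
  length_ctx : List.length ctx = n
  derivable : Derivable Λ ⟨ctx, .type ty⟩

/-- A derived term judgement of degree `n + 1`. -/
@[ext] structure TmJ (n : ℕ) : Type u where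
  ctx : Ctx K
  tm : Expr K
  ty : Expr K
  length_ctx : List.length ctx = n
  derivable : Derivable Λ ⟨ctx, .term tm ty⟩

/-- The relation `≡` between the type judgements
`x₁ : S₁, …, xₙ₋₁ : Sₙ₋₁ ⊢ Sₙ type` and `y₁ : T₁, …, yₘ₋₁ : Tₘ₋₁ ⊢ Tₘ type`: one has `n = m`, and
`x₁ : S₁, …, xᵢ₋₁ : Sᵢ₋₁ ⊢ Sᵢ = Tᵢ[x₁/y₁, …, xᵢ₋₁/yᵢ₋₁] type` is derived for each `i`. -/
def TypeCong : Ctx K → Expr K → Ctx K → Expr K → Prop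
  | [], S, [], T => Derivable Λ ⟨[], .typeEq S T⟩
  | (x, S') :: Γ, S, (y, T') :: Δ, T =>
      TypeCong Γ S' Δ T' ∧
        Derivable Λ ⟨(x, S') :: Γ,
          .typeEq S (T.rename (Ctx.varSubst ((x, S') :: Γ) ((y, T') :: Δ)))⟩
  | _, _, _, _ => False

/-- The relation `≡` on type judgements of degree `n + 1`. -/
def tyRel (n : ℕ) (J J' : TyJ Λ n) : Prop :=
  TypeCong Λ J.ctx J.ty J'.ctx J'.ty

/-- The relation `≡` on term judgements of degree `n + 1`: the boundaries are related, and
`x₁ : S₁, …, xₙ : Sₙ ⊢ s = t[x₁/y₁, …, xₙ/yₙ] : S` is derived. -/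
def tmRel (n : ℕ) (J J' : TmJ Λ n) : Prop :=
  TypeCong Λ J.ctx J.ty J'.ctx J'.ty ∧
    Derivable Λ ⟨J.ctx, .termEq J.tm (J'.tm.rename (Ctx.varSubst J.ctx J'.ctx)) J.ty⟩

variable {Λ}

/-- The boundary of a type judgement. -/
def TyJ.bd {n : ℕ} (J : TyJ Λ (n + 1)) : TyJ Λ n :=
  match J with
  | ⟨[], _, h, _⟩ => absurd h (by simp)
  | ⟨(_, T) :: Γ, _, h, d⟩ => ⟨Γ, T, by simpa using h, d.ctx_tail⟩

/-- The boundary of a term judgement. -/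
def TmJ.bd {n : ℕ} (J : TmJ Λ n) : TyJ Λ n :=
  ⟨J.ctx, J.ty, J.length_ctx, J.derivable.term_type⟩

theorem tyRel_bd (n : ℕ) (J J' : TyJ Λ (n + 1)) (h : tyRel Λ (n + 1) J J') :
    tyRel Λ n J.bd J'.bd := by
  obtain ⟨Γ, S, l, d⟩ := J
  obtain ⟨Δ, T, l', d'⟩ := J'
  cases Γ with
  | nil => simp at l
  | cons a Γ =>
    cases Δ with
    | nil => simp at l'
    | cons b Δ => exact h.1

variable (Λ)

/-- The type-and-term structure of derived type and term judgements modulo (the equivalence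
relation generated by) `≡`. -/
def judgementStruct : TTStruct.{u} :=
  TTStruct.mk (fun n => Quot (tyRel Λ n)) (fun n => Quot (tmRel Λ n))
    (fun n => Quot.map TyJ.bd (tyRel_bd n))
    (fun _ => Quot.map TmJ.bd (fun _ _ h => h.1))

end Underlying

/-- The value `V𝕋` of the forgetful functor at a theory `𝕋`. -/
def WGAT.underlying (𝕋 : WGAT.{u}) : TTStruct.{u} := judgementStruct 𝕋.basic

section Relabel

variable {K L : Type u} {Λ : Set (Judgement K)} {Λ' : Set (Judgement L)} (g : K → L)
  (hg : ∀ J ∈ Λ, J.mapConst g ∈ Λ')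

/-- The action on derived type judgements of a map of constants which preserves basic
judgements. -/
def TyJ.map {n : ℕ} (J : TyJ Λ n) : TyJ Λ' n where
  ctx := J.ctx.mapConst g
  ty := J.ty.mapConst g
  length_ctx := by rw [Ctx.mapConst, List.length_map, J.length_ctx]
  derivable := J.derivable.mapConst g hg

/-- The action on derived term judgements of a map of constants which preserves basic
judgements. -/
def TmJ.map {n : ℕ} (J : TmJ Λ n) : TmJ Λ' n where
  ctx := J.ctx.mapConst g
  tm := J.tm.mapConst g
  ty := J.ty.mapConst g
  length_ctx := by rw [Ctx.mapConst, List.length_map, J.length_ctx]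
  derivable := J.derivable.mapConst g hg

theorem typeCong_map (hg : ∀ J ∈ Λ, J.mapConst g ∈ Λ') : ∀ (Γ : Ctx K) (S : Expr K) (Δ : Ctx K) (T : Expr K),
    TypeCong Λ Γ S Δ T →
      TypeCong Λ' (Γ.mapConst g) (S.mapConst g) (Δ.mapConst g) (T.mapConst g)
  | [], _, [], _, h => h.mapConst g hg
  | (x, S') :: Γ, S, (y, T') :: Δ, T, h => by
    refine ⟨typeCong_map hg Γ S' Δ T' h.1, ?_⟩
    have := h.2.mapConst g hg
    simp only [Judgement.mapConst, Assertion.mapConst, Expr.rename_mapConst] at this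
    rw [← Ctx.varSubst_mapConst g] at this
    exact this
  | [], _, _ :: _, _, h => h.elim
  | _ :: _, _, [], _, h => h.elim

theorem tyRel_map (n : ℕ) (J J' : TyJ Λ n) (h : tyRel Λ n J J') :
    tyRel Λ' n (J.map g hg) (J'.map g hg) :=
  typeCong_map g hg _ _ _ _ h

theorem tmRel_map (n : ℕ) (J J' : TmJ Λ n) (h : tmRel Λ n J J') :
    tmRel Λ' n (J.map g hg) (J'.map g hg) := by
  refine ⟨typeCong_map g hg _ _ _ _ h.1, ?_⟩
  have := h.2.mapConst g hg
  simp only [Judgement.mapConst, Assertion.mapConst, Expr.rename_mapConst] at this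
  rw [← Ctx.varSubst_mapConst g] at this
  exact this

theorem TyJ.map_bd {n : ℕ} (J : TyJ Λ (n + 1)) : J.bd.map g hg = (J.map g hg).bd := by
  obtain ⟨Γ, S, l, d⟩ := J
  cases Γ with
  | nil => simp at l
  | cons a Γ => rfl

/-- The map of type-and-term structures induced by a map of constants which preserves basic
judgements. -/
def judgementMap : judgementStruct Λ ⟶ judgementStruct Λ' :=
  TTStruct.homMk
    (fun n => Quot.map (TyJ.map g hg) (tyRel_map g hg n))
    (fun n => Quot.map (TmJ.map g hg) (tmRel_map g hg n))
    (fun _ A => Quot.inductionOn A fun J => congrArg (Quot.mk _) (TyJ.map_bd g hg J))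
    (fun _ a => Quot.inductionOn a fun _ => rfl)

end Relabel

/-! ### The free theory and the weakening monad -/

namespace TTStruct

/-- The type-constants of the free theory: all type-elements of `X`. -/
abbrev TyC (X : TTStruct.{u}) : Type u := Σ n, X.Ty n

/-- The term-constants of the free theory: all term-elements of `X`. -/
abbrev TmC (X : TTStruct.{u}) : Type u := Σ n, X.TmEl n

/-- The context `x₁ : A₁, x₂ : A₂(x₁), …, xₙ : Aₙ(x₁, …, xₙ₋₁)` attached to a type-element `A` of
degree `n + 1` with successive boundaries `Aₙ, …, A₁`; the variables used are `0, …, n - 1`. -/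
def genCtx (X : TTStruct.{u}) : ∀ n, X.Ty n → Ctx (X.TyC ⊕ X.TmC)
  | 0, _ => []
  | n + 1, A =>
      (n, Expr.appVars (.inl ⟨n, X.bd A⟩) (List.range n)) :: genCtx X n (X.bd A)

/-- The basic judgement `x₁ : A₁, …, xₙ : Aₙ(x₁, …, xₙ₋₁) ⊢ A(x₁, …, xₙ) type`. -/
def tyAxiom (X : TTStruct.{u}) (A : X.TyC) : Judgement (X.TyC ⊕ X.TmC) :=
  ⟨X.genCtx A.1 A.2, .type (Expr.appVars (.inl A) (List.range A.1))⟩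

/-- The basic judgement `x₁ : A₁, …, xₙ : Aₙ(x₁, …, xₙ₋₁) ⊢ a(x₁, …, xₙ) : A(x₁, …, xₙ)`, where
`A` is the boundary of `a`. -/
def tmAxiom (X : TTStruct.{u}) (a : X.TmC) : Judgement (X.TyC ⊕ X.TmC) :=
  ⟨X.genCtx a.1 (X.tmBd a.2), .term (Expr.appVars (.inr a) (List.range a.1))
    (Expr.appVars (.inl ⟨a.1, X.tmBd a.2⟩) (List.range a.1))⟩

/-- The basic judgements of the free theory. -/
def freeBasic (X : TTStruct.{u}) : Set (Judgement (X.TyC ⊕ X.TmC)) :=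
  Set.range X.tyAxiom ∪ Set.range X.tmAxiom

theorem vars_genCtx (X : TTStruct.{u}) : ∀ n (A : X.Ty n), (X.genCtx n A).vars = List.range n
  | 0, _ => rfl
  | n + 1, A => by
    have := vars_genCtx X n (X.bd A)
    rw [Ctx.vars] at this
    simp only [genCtx, Ctx.vars, List.map_cons, List.reverse_cons, this, List.range_succ]

theorem derivable_tyAxiom (X : TTStruct.{u}) :
    ∀ n (A : X.Ty n), Derivable X.freeBasic (X.tyAxiom ⟨n, A⟩)
  | 0, A => .basic (Or.inl ⟨_, rfl⟩) (by simp [tyAxiom, genCtx, Judgement.boundary])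
  | n + 1, A => .basic (Or.inl ⟨_, rfl⟩) (by
      simp only [tyAxiom, genCtx, Judgement.boundary, List.mem_singleton, forall_eq]
      exact derivable_tyAxiom X n (X.bd A))

theorem derivable_tmAxiom (X : TTStruct.{u}) (a : X.TmC) :
    Derivable X.freeBasic (X.tmAxiom a) :=
  .basic (Or.inr ⟨_, rfl⟩) (by
    have : (X.tmAxiom a).boundary = [X.tyAxiom ⟨a.1, X.tmBd a.2⟩] := by
      obtain ⟨n, a⟩ := a
      cases n <;> rfl
    rw [this]
    simp only [List.mem_singleton, forall_eq]
    exact derivable_tyAxiom X _ _)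

theorem appVars_inj {K : Type u} {v w : K} {l l' : List ℕ}
    (h : Expr.appVars v l = Expr.appVars w l') : v = w := by
  simp only [Expr.appVars, Expr.app.injEq] at h
  exact h.1

/-- The free `{w}`-GAT `GX` on a type-and-term structure `X`. -/
def free (X : TTStruct.{u}) : WGAT.{u} where
  TyConst := X.TyC
  TmConst := X.TmC
  basic := X.freeBasic
  vars_nodup := by
    rintro J (⟨A, rfl⟩ | ⟨a, rfl⟩)
    · simpa only [tyAxiom, vars_genCtx] using List.nodup_range
    · simpa only [tmAxiom, vars_genCtx] using List.nodup_range
  tyConst_unique A := by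
    refine ⟨X.tyAxiom A, ⟨Or.inl ⟨A, rfl⟩, ?_⟩, ?_⟩
    · simp only [Judgement.Introduces, tyAxiom, vars_genCtx]
    · rintro J ⟨⟨B, rfl⟩ | ⟨b, rfl⟩, h⟩
      · simp only [Judgement.Introduces, tyAxiom, Assertion.type.injEq] at h
        rw [Sum.inl.inj (appVars_inj h)]
      · simp [Judgement.Introduces, tmAxiom] at h
  tmConst_unique a := by
    refine ⟨X.tmAxiom a, ⟨Or.inr ⟨a, rfl⟩, ?_⟩, ?_⟩
    · simp only [Judgement.IntroducesTerm, tmAxiom, vars_genCtx]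
      exact ⟨_, rfl⟩
    · rintro J ⟨⟨B, rfl⟩ | ⟨b, rfl⟩, T, h⟩
      · simp [tyAxiom] at h
      · simp only [tmAxiom, Assertion.term.injEq] at h
        rw [Sum.inr.inj (appVars_inj h.1)]
  basic_form := by
    rintro J (⟨A, rfl⟩ | ⟨a, rfl⟩)
    · exact Or.inl ⟨A, by simp only [Judgement.Introduces, tyAxiom, vars_genCtx]⟩
    · refine Or.inr (Or.inl ⟨a, ?_⟩)
      simp only [Judgement.IntroducesTerm, tmAxiom, vars_genCtx]
      exact ⟨_, rfl⟩
  basic_derivable := by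
    rintro J (⟨A, rfl⟩ | ⟨a, rfl⟩)
    · exact derivable_tyAxiom X _ _
    · exact derivable_tmAxiom X a

/-- The action of `f : X ⟶ Y` on the constants of the free theories. -/
def mapC {X Y : TTStruct.{u}} (f : X ⟶ Y) : X.TyC ⊕ X.TmC → Y.TyC ⊕ Y.TmC
  | .inl ⟨n, A⟩ => .inl ⟨n, mapTy f A⟩
  | .inr ⟨n, a⟩ => .inr ⟨n, mapTmEl f a⟩

theorem mapC_id (X : TTStruct.{u}) : mapC (𝟙 X) = id := by
  funext c
  rcases c with ⟨n, A⟩ | ⟨n, a⟩ <;> rfl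

theorem mapC_comp {X Y Z : TTStruct.{u}} (f : X ⟶ Y) (g : Y ⟶ Z) :
    mapC (f ≫ g) = mapC g ∘ mapC f := by
  funext c
  rcases c with ⟨n, A⟩ | ⟨n, a⟩ <;> rfl

theorem genCtx_map {X Y : TTStruct.{u}} (f : X ⟶ Y) : ∀ n (A : X.Ty n),
    (X.genCtx n A).mapConst (mapC f) = Y.genCtx n (mapTy f A)
  | 0, _ => rfl
  | n + 1, A => by
    have := genCtx_map f n (X.bd A)
    simp only [Ctx.mapConst] at this
    simp only [genCtx, Ctx.mapConst, List.map_cons, Expr.mapConst_appVars, mapC, this, mapTy_bd]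

theorem freeBasic_map {X Y : TTStruct.{u}} (f : X ⟶ Y) :
    ∀ J ∈ X.freeBasic, J.mapConst (mapC f) ∈ Y.freeBasic := by
  rintro J (⟨A, rfl⟩ | ⟨a, rfl⟩)
  · refine Or.inl ⟨⟨A.1, mapTy f A.2⟩, ?_⟩
    simp only [tyAxiom, Judgement.mapConst, genCtx_map, Assertion.mapConst,
      Expr.mapConst_appVars, mapC]
  · refine Or.inr ⟨⟨a.1, mapTmEl f a.2⟩, ?_⟩
    simp only [tmAxiom, Judgement.mapConst, genCtx_map, Assertion.mapConst,
      Expr.mapConst_appVars, mapC, mapTy_tmBd]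

end TTStruct

/-- The underlying endofunctor `W = V ∘ G` of the weakening monad. Its action on `f : X ⟶ Y` comes
from the interpretation `GX → GY` which replaces each constant by its image under `f`. -/
def weakeningFunctor : TTStruct.{u} ⥤ TTStruct.{u} where
  obj X := X.free.underlying
  map f := judgementMap (TTStruct.mapC f) (TTStruct.freeBasic_map f)
  map_id X := by
    refine TTStruct.hom_ext (fun n A => ?_) (fun n a => ?_)
    · refine Quot.inductionOn A fun J => congrArg (Quot.mk _) (TyJ.ext ?_ ?_)
      · exact (congrArg (fun g => J.ctx.mapConst g) (TTStruct.mapC_id X)).trans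
          (Ctx.mapConst_id _)
      · exact (congrArg (fun g => J.ty.mapConst g) (TTStruct.mapC_id X)).trans
          (Expr.mapConst_id _)
    · refine Quot.inductionOn a fun J => congrArg (Quot.mk _) (TmJ.ext ?_ ?_ ?_)
      · exact (congrArg (fun g => J.ctx.mapConst g) (TTStruct.mapC_id X)).trans
          (Ctx.mapConst_id _)
      · exact (congrArg (fun g => J.tm.mapConst g) (TTStruct.mapC_id X)).trans
          (Expr.mapConst_id _)
      · exact (congrArg (fun g => J.ty.mapConst g) (TTStruct.mapC_id X)).trans
          (Expr.mapConst_id _)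
  map_comp f g := by
    refine TTStruct.hom_ext (fun n A => ?_) (fun n a => ?_)
    · refine Quot.inductionOn A fun J => congrArg (Quot.mk _) (TyJ.ext ?_ ?_)
      · exact (congrArg (fun k => J.ctx.mapConst k) (TTStruct.mapC_comp f g)).trans
          (Ctx.mapConst_comp _ _ _)
      · exact (congrArg (fun k => J.ty.mapConst k) (TTStruct.mapC_comp f g)).trans
          (Expr.mapConst_comp _ _ _)
    · refine Quot.inductionOn a fun J => congrArg (Quot.mk _) (TmJ.ext ?_ ?_ ?_)
      · exact (congrArg (fun k => J.ctx.mapConst k) (TTStruct.mapC_comp f g)).trans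
          (Ctx.mapConst_comp _ _ _)
      · exact (congrArg (fun k => J.tm.mapConst k) (TTStruct.mapC_comp f g)).trans
          (Expr.mapConst_comp _ _ _)
      · exact (congrArg (fun k => J.ty.mapConst k) (TTStruct.mapC_comp f g)).trans
          (Expr.mapConst_comp _ _ _)

/-! In the free theory only variables are ever put into a constant, and no basic judgement is an
equality. So derived equality is syntactic, and every derivable type is of the form `A(x₁, …, xₖ)`
with `A` a type-element of degree `k + 1` and the `xᵢ` declared variables. Moreover `xₖ` must be
declared with type `∂A(x₁, …, xₖ₋₁)`, so the last argument determines the others. A type judgement,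
up to the names of its variables, therefore amounts to a choice, for each of its types, of a
type-element and of an earlier declaration as parent (none in degree one), where the parent carries
the boundary of the type-element. This is a min-heap `φ` with a map `[φ] ⟶ X`; the arguments of a
type form the branch of `φ` ending at its parent. A term of type `A(l)` is `a(l)` with `∂a = A`,
that is, an element of `Tm_X(A)`.

The description of derivable judgements has two halves. `holds_of_derivable` is an induction on
derivations. Conversely, `DependsOn.derivable` removes, by weakening, the declarations which are not
arguments; what remains is the context of a basic judgement up to a permutation of variables.

Renaming the declared variables to `0, …, n - 1` gives normal forms. `exists_heapTy` reads off a
heap from a normal form, whence surjectivity. For injectivity, the list of types with variables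
replaced by their positions (`Ctx.standardize`) is invariant under `≡` and recovers the normal form.
-/

/-! ### Expressions and contexts -/

namespace Expr

variable {K : Type u}

/-- The variables `x₁, …, xₖ` of an expression `w(x₁, …, xₖ)`. -/
def argVars : Expr K → List ℕ
  | var _ => []
  | app _ args => List.ofFn fun i =>
      match args i with
      | var x => x
      -- Junk value: only constants applied to variables matter.
      | app _ _ => 0

theorem argVars_appVars (w : K) (l : List ℕ) : (appVars w l).argVars = l := by
  simp only [appVars, argVars, List.ofFn_get]

/-- Reading the list back with `argVars` avoids comparing argument functions whose domains depend on
the length. -/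
theorem appVars_injective {v w : K} {l l' : List ℕ} (h : appVars v l = appVars w l') :
    v = w ∧ l = l' := by
  refine ⟨TTStruct.appVars_inj h, ?_⟩
  rw [← argVars_appVars v l, h, argVars_appVars]

theorem app_eq_appVars (w : K) (l : List ℕ) {n : ℕ} (h : n = l.length) (g : Fin n → ℕ)
    (hg : ∀ i, g i = l.get (Fin.cast h i)) : app w (fun i => var (g i)) = appVars w l := by
  subst h
  obtain rfl : g = l.get := funext hg
  rfl

theorem rename_appVars (f : ℕ → ℕ) (w : K) (l : List ℕ) :
    (appVars w l).rename f = appVars w (l.map f) := by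
  simp only [appVars, rename]
  exact app_eq_appVars w (l.map f) (by simp) _ (by simp)

theorem mem_fv_appVars {w : K} {l : List ℕ} {x : ℕ} : x ∈ (appVars w l).fv ↔ x ∈ l := by
  simp only [appVars, fv, Set.mem_iUnion, Set.mem_singleton_iff]
  rw [List.mem_iff_get]
  exact exists_congr fun _ => eq_comm

theorem rename_congr {f g : ℕ → ℕ} {e : Expr K} (h : ∀ v ∈ e.fv, f v = g v) :
    e.rename f = e.rename g := by
  induction e with
  | var x => exact congrArg var (h x rfl)
  | app w args ih =>
    simp only [rename]
    congr 1
    funext i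
    exact ih i fun v hv => h v (Set.mem_iUnion.2 ⟨i, hv⟩)

theorem rename_rename (f g : ℕ → ℕ) (e : Expr K) :
    (e.rename f).rename g = e.rename (g ∘ f) := by
  induction e with
  | var x => rfl
  | app w args ih => simp only [rename, ih]

theorem rename_id (e : Expr K) : e.rename id = e := by
  induction e with
  | var x => rfl
  | app w args ih => simp only [rename, ih]

end Expr

/-- The `α` rule allows only permutations of all variables, so a bijection between finite lists has
to be extended; the symmetric group acts `k`-transitively for every `k`. -/
theorem exists_perm_map_eq {l l' : List ℕ} (h : l.Nodup) (h' : l'.Nodup)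
    (e : l.length = l'.length) : ∃ σ : Equiv.Perm ℕ, l.map σ = l' := by
  let x : Fin l.length ↪ ℕ := ⟨l.get, List.nodup_iff_injective_get.1 h⟩
  let y : Fin l.length ↪ ℕ := ⟨fun i => l'.get (Fin.cast e i),
    (List.nodup_iff_injective_get.1 h').comp (Fin.cast_injective e)⟩
  obtain ⟨σ, hσ⟩ := (Equiv.Perm.isMultiplyPretransitive ℕ l.length).exists_smul_eq x y
  refine ⟨σ, List.ext_getElem (by simpa using e) fun i hi _ => ?_⟩
  have := DFunLike.congr_fun hσ ⟨i, by simpa using hi⟩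
  simpa [x, y] using this

/-! ### Derivable judgements of the free theory -/

namespace TTStruct

variable {X : TTStruct.{u}}

/-- `X.DependsOn Γ A l` says that `A(l)` is obtained from the basic judgement for `A` by means of
variables declared in `Γ`: the list `l` is empty if `A` has degree one, and otherwise its last
member is declared in `Γ` with type `∂A(l')`, where `l'` consists of the preceding members. -/
inductive DependsOn (X : TTStruct.{u}) (Γ : Ctx (X.TyC ⊕ X.TmC)) : X.TyC → List ℕ → Prop
  | root (A : X.Ty 0) : DependsOn X Γ ⟨0, A⟩ []
  | child {n : ℕ} (A : X.Ty (n + 1)) (l : List ℕ) (x : ℕ)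
      (h : (x, Expr.appVars (.inl ⟨n, X.bd A⟩) l) ∈ Γ) : DependsOn X Γ ⟨n + 1, A⟩ (l ++ [x])

/-- The expressions `T` for which `Γ ⊢ T type` is derivable in the free theory. -/
def IsType (X : TTStruct.{u}) (Γ : Ctx (X.TyC ⊕ X.TmC)) (T : Expr (X.TyC ⊕ X.TmC)) : Prop :=
  ∃ A l, T = Expr.appVars (.inl A) l ∧ X.DependsOn Γ A l

/-- The expressions `t` and `T` for which `Γ ⊢ t : T` is derivable in the free theory. -/
def IsTerm (X : TTStruct.{u}) (Γ : Ctx (X.TyC ⊕ X.TmC)) (t T : Expr (X.TyC ⊕ X.TmC)) : Prop :=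
  ∃ (a : X.TmC) (l : List ℕ), t = Expr.appVars (.inr a) l ∧
    T = Expr.appVars (.inl ⟨a.1, X.tmBd a.2⟩) l ∧ X.DependsOn Γ ⟨a.1, X.tmBd a.2⟩ l

/-- The well-formed contexts of the free theory. -/
def IsCtx (X : TTStruct.{u}) : Ctx (X.TyC ⊕ X.TmC) → Prop
  | [] => True
  | (x, T) :: Γ => IsCtx X Γ ∧ x ∉ List.map Prod.fst Γ ∧ X.IsType Γ T

/-- The assertions which can be derived in the context `Γ` of the free theory. -/
def Holds (X : TTStruct.{u}) (Γ : Ctx (X.TyC ⊕ X.TmC)) : Assertion (X.TyC ⊕ X.TmC) → Prop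
  | .type T => X.IsType Γ T
  | .term t T => X.IsTerm Γ t T
  | .typeEq T T' => T = T' ∧ X.IsType Γ T
  | .termEq t t' T => t = t' ∧ X.IsTerm Γ t T

/-- The context enters only through membership, so a declaration may be inserted at any position;
this settles the conclusion of the weakening rule. -/
theorem DependsOn.mono {Γ Δ : Ctx (X.TyC ⊕ X.TmC)} {A : X.TyC} {l : List ℕ}
    (h : X.DependsOn Γ A l) (hs : Γ ⊆ Δ) : X.DependsOn Δ A l := by
  cases h with
  | root A => exact .root A
  | child A l x h => exact .child A l x (hs h)

theorem IsType.mono {Γ Δ : Ctx (X.TyC ⊕ X.TmC)} {T : Expr (X.TyC ⊕ X.TmC)}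
    (h : X.IsType Γ T) (hs : Γ ⊆ Δ) : X.IsType Δ T := by
  obtain ⟨A, l, e, h⟩ := h
  exact ⟨A, l, e, h.mono hs⟩

theorem IsTerm.mono {Γ Δ : Ctx (X.TyC ⊕ X.TmC)} {t T : Expr (X.TyC ⊕ X.TmC)}
    (h : X.IsTerm Γ t T) (hs : Γ ⊆ Δ) : X.IsTerm Δ t T := by
  obtain ⟨a, l, e, e', h⟩ := h
  exact ⟨a, l, e, e', h.mono hs⟩

theorem Holds.mono {Γ Δ : Ctx (X.TyC ⊕ X.TmC)} {𝒥 : Assertion (X.TyC ⊕ X.TmC)}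
    (h : X.Holds Γ 𝒥) (hs : Γ ⊆ Δ) : X.Holds Δ 𝒥 := by
  cases 𝒥 with
  | type T => exact IsType.mono h hs
  | term t T => exact IsTerm.mono h hs
  | typeEq T T' => exact ⟨h.1, h.2.mono hs⟩
  | termEq t t' T => exact ⟨h.1, h.2.mono hs⟩

theorem DependsOn.rename (f : ℕ → ℕ) {Γ : Ctx (X.TyC ⊕ X.TmC)} {A : X.TyC} {l : List ℕ}
    (h : X.DependsOn Γ A l) : X.DependsOn (Γ.rename f) A (l.map f) := by
  cases h with
  | root A => exact .root A
  | child A l x h =>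
    rw [List.map_append]
    refine .child A _ _ ?_
    rw [← Expr.rename_appVars]
    exact List.mem_map_of_mem (f := fun d : ℕ × Expr _ => (f d.1, d.2.rename f)) h

theorem IsType.rename (f : ℕ → ℕ) {Γ : Ctx (X.TyC ⊕ X.TmC)} {T : Expr (X.TyC ⊕ X.TmC)}
    (h : X.IsType Γ T) : X.IsType (Γ.rename f) (T.rename f) := by
  obtain ⟨A, l, rfl, h⟩ := h
  exact ⟨A, _, Expr.rename_appVars _ _ _, h.rename f⟩

theorem IsTerm.rename (f : ℕ → ℕ) {Γ : Ctx (X.TyC ⊕ X.TmC)} {t T : Expr (X.TyC ⊕ X.TmC)}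
    (h : X.IsTerm Γ t T) : X.IsTerm (Γ.rename f) (t.rename f) (T.rename f) := by
  obtain ⟨a, l, rfl, rfl, h⟩ := h
  exact ⟨a, _, Expr.rename_appVars _ _ _, Expr.rename_appVars _ _ _, h.rename f⟩

theorem Holds.rename (f : ℕ → ℕ) {Γ : Ctx (X.TyC ⊕ X.TmC)} {𝒥 : Assertion (X.TyC ⊕ X.TmC)}
    (h : X.Holds Γ 𝒥) : X.Holds (Γ.rename f) (𝒥.rename f) := by
  cases 𝒥 with
  | type T => exact IsType.rename f h
  | term t T => exact IsTerm.rename f h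
  | typeEq T T' => exact ⟨congrArg _ h.1, h.2.rename f⟩
  | termEq t t' T => exact ⟨congrArg _ h.1, h.2.rename f⟩

/-- Injectivity serves only to keep the declared variables distinct. -/
theorem IsCtx.rename {f : ℕ → ℕ} (hf : Function.Injective f) :
    ∀ {Γ : Ctx (X.TyC ⊕ X.TmC)}, X.IsCtx Γ → X.IsCtx (Γ.rename f)
  | [], _ => trivial
  | (x, T) :: Γ, h => by
    refine ⟨h.1.rename hf, fun hx => h.2.1 ?_, h.2.2.rename f⟩
    simp only [List.map_map, List.mem_map, Function.comp] at hx ⊢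
    obtain ⟨d, hd, e⟩ := hx
    exact ⟨d, hd, hf e⟩

theorem dependsOn_genCtx (X : TTStruct.{u}) :
    ∀ n (A : X.Ty n), X.DependsOn (X.genCtx n A) ⟨n, A⟩ (List.range n)
  | 0, A => .root A
  | n + 1, A => by
    rw [List.range_succ]
    exact .child A _ _ (List.mem_cons_self ..)

theorem isCtx_genCtx (X : TTStruct.{u}) : ∀ n (A : X.Ty n), X.IsCtx (X.genCtx n A)
  | 0, _ => trivial
  | n + 1, A => by
    refine ⟨isCtx_genCtx X n (X.bd A), ?_, ⟨_, _, rfl, dependsOn_genCtx X n (X.bd A)⟩⟩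
    have := vars_genCtx X n (X.bd A)
    rw [Ctx.vars, List.reverse_eq_iff] at this
    rw [this]
    simp

theorem subset_weaken (Δ Γ : Ctx (X.TyC ⊕ X.TmC)) (d : ℕ × Expr (X.TyC ⊕ X.TmC)) :
    Δ ++ Γ ⊆ Δ ++ d :: Γ := fun _ hz =>
  (List.mem_append.1 hz).elim (fun h => List.mem_append_left _ h)
    fun h => List.mem_append_right _ (List.mem_cons_of_mem _ h)

theorem IsCtx.weaken {Γ : Ctx (X.TyC ⊕ X.TmC)} {y : ℕ} {T : Expr (X.TyC ⊕ X.TmC)}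
    (hT : X.IsType Γ T) (hΓ : y ∉ Γ.fv) : ∀ {Δ : Ctx (X.TyC ⊕ X.TmC)}, X.IsCtx (Δ ++ Γ) →
      y ∉ Δ.fv → X.IsCtx (Δ ++ (y, T) :: Γ)
  | [], h, _ => by
    refine ⟨h, fun hy => hΓ ?_, hT⟩
    obtain ⟨d, hd, rfl⟩ := List.mem_map.1 hy
    exact ⟨d, hd, Or.inl rfl⟩
  | (x, S) :: Δ, h, hΔ => by
    refine ⟨h.1.weaken hT hΓ fun ⟨d, hd, hy⟩ => hΔ ⟨d, List.mem_cons_of_mem _ hd, hy⟩, ?_,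
      h.2.2.mono (subset_weaken Δ Γ _)⟩
    intro hx
    obtain ⟨d, hd, rfl⟩ := List.mem_map.1 hx
    rcases List.mem_append.1 hd with hd | hd
    · exact h.2.1 (List.mem_map_of_mem (List.mem_append_left _ hd))
    · rcases List.mem_cons.1 hd with rfl | hd
      · exact hΔ ⟨_, List.mem_cons_self .., Or.inl rfl⟩
      · exact h.2.1 (List.mem_map_of_mem (List.mem_append_right _ hd))

/-- Induction on the derivation. Since no basic judgement is an equality, equalities arise from
reflexivity alone and stay syntactic, which makes the conversion rules vacuous. -/
theorem holds_of_derivable {J : Judgement (X.TyC ⊕ X.TmC)} (h : Derivable X.freeBasic J) :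
    X.IsCtx J.ctx ∧ X.Holds J.ctx J.concl := by
  induction h with
  | basic hJ _ _ =>
    obtain ⟨A, rfl⟩ | ⟨a, rfl⟩ := hJ
    · exact ⟨isCtx_genCtx X _ _, _, _, rfl, dependsOn_genCtx X _ _⟩
    · exact ⟨isCtx_genCtx X _ _, _, _, rfl, rfl, dependsOn_genCtx X _ _⟩
  | termRefl _ ih => exact ⟨ih.1, rfl, ih.2⟩
  | termSymm _ ih =>
    obtain ⟨h, rfl, h'⟩ := ih
    exact ⟨h, rfl, h'⟩
  | termTrans _ _ ih₁ ih₂ =>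
    obtain ⟨h, rfl, h'⟩ := ih₁
    exact ih₂
  | typeRefl _ ih => exact ⟨ih.1, rfl, ih.2⟩
  | typeSymm _ ih =>
    obtain ⟨h, rfl, h'⟩ := ih
    exact ⟨h, rfl, h'⟩
  | typeTrans _ _ ih₁ ih₂ =>
    obtain ⟨h, rfl, h'⟩ := ih₁
    exact ih₂
  | termConv _ _ ih₁ ih₂ =>
    obtain ⟨h, rfl, h'⟩ := ih₁
    exact ih₂
  | termEqConv _ _ ih₁ ih₂ =>
    obtain ⟨h, rfl, h'⟩ := ih₁
    exact ih₂
  | alpha σ _ ih => exact ⟨ih.1.rename σ.injective, ih.2.rename σ⟩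
  | @weaken Γ Δ y T 𝒥 _ _ hΓ hΔ ih₁ ih₂ =>
    exact ⟨ih₂.1.weaken ih₁.2 hΓ hΔ, ih₂.2.mono (subset_weaken Δ Γ _)⟩

/-! ### Argument lists as branches in a well-formed context -/

theorem IsCtx.nodup : ∀ {Γ : Ctx (X.TyC ⊕ X.TmC)}, X.IsCtx Γ → (List.map Prod.fst Γ).Nodup
  | [], _ => List.nodup_nil
  | _ :: _, h => List.nodup_cons.2 ⟨h.2.1, h.1.nodup⟩

theorem IsCtx.isType_of_mem : ∀ {Γ : Ctx (X.TyC ⊕ X.TmC)}, X.IsCtx Γ → ∀ {x S}, (x, S) ∈ Γ →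
    X.IsType Γ S
  | (_, _) :: _, h, x, S, hm => by
    rcases List.mem_cons.1 hm with e | hm
    · cases e
      exact h.2.2.mono (List.subset_cons_self _ _)
    · exact (h.1.isType_of_mem hm).mono (List.subset_cons_self _ _)

/-- Induction along successive boundaries, for type-elements in a well-formed context. -/
theorem DependsOn.induction {Γ : Ctx (X.TyC ⊕ X.TmC)} (hΓ : X.IsCtx Γ)
    {P : X.TyC → List ℕ → Prop} (root : ∀ A : X.Ty 0, P ⟨0, A⟩ [])
    (child : ∀ (n : ℕ) (A : X.Ty (n + 1)) (l : List ℕ) (x : ℕ),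
      (x, Expr.appVars (.inl ⟨n, X.bd A⟩) l) ∈ Γ → P ⟨n, X.bd A⟩ l → P ⟨n + 1, A⟩ (l ++ [x])) :
    ∀ (n : ℕ) (A : X.Ty n) (l : List ℕ), X.DependsOn Γ ⟨n, A⟩ l → P ⟨n, A⟩ l
  | 0, _, _, .root A => root A
  | n + 1, _, _, .child A l x h => by
    obtain ⟨B, l', e, hB⟩ := hΓ.isType_of_mem h
    obtain ⟨e', rfl⟩ := Expr.appVars_injective e
    obtain rfl := Sum.inl.inj e'
    exact child n A l x h (DependsOn.induction hΓ root child n _ l hB)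

/-- The last argument of a type is declared earlier, and the other arguments occur in the type of
that last one, so recursion applies to them. -/
theorem IsCtx.mem_of_mem_fv : ∀ {Γ : Ctx (X.TyC ⊕ X.TmC)}, X.IsCtx Γ →
    ∀ {x S}, (x, S) ∈ Γ → ∀ {v}, v ∈ S.fv → v ∈ List.map Prod.fst Γ ∧ v ≠ x
  | (y, T) :: Γ, h, x, S, hm, v, hv => by
    rcases List.mem_cons.1 hm with e | hm
    · cases e
      obtain ⟨A, l, rfl, hA⟩ := h.2.2
      rw [Expr.mem_fv_appVars] at hv
      have : v ∈ List.map Prod.fst Γ := by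
        cases hA with
        | root A => simp at hv
        | child A l z hz =>
          rcases List.mem_append.1 hv with hv | hv
          · exact (h.1.mem_of_mem_fv hz (Expr.mem_fv_appVars.2 hv)).1
          · rw [List.mem_singleton] at hv
            subst hv
            exact List.mem_map_of_mem (f := Prod.fst) hz
      exact ⟨List.mem_cons_of_mem _ this, fun e => h.2.1 (e ▸ this)⟩
    · obtain ⟨h1, h2⟩ := h.1.mem_of_mem_fv hm hv
      exact ⟨List.mem_cons_of_mem _ h1, h2⟩

theorem DependsOn.mem {Γ : Ctx (X.TyC ⊕ X.TmC)} (hΓ : X.IsCtx Γ) {A : X.TyC} {l : List ℕ}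
    (h : X.DependsOn Γ A l) {v : ℕ} (hv : v ∈ l) : v ∈ List.map Prod.fst Γ := by
  cases h with
  | root A => simp at hv
  | child A l z hz =>
    rcases List.mem_append.1 hv with hv | hv
    · exact (hΓ.mem_of_mem_fv hz (Expr.mem_fv_appVars.2 hv)).1
    · rw [List.mem_singleton] at hv
      subst hv
      exact List.mem_map_of_mem (f := Prod.fst) hz

/-- Each boundary accounts for one argument, and the argument added is new because the preceding
ones occur in its type while it does not. -/
theorem DependsOn.nodup_length {Γ : Ctx (X.TyC ⊕ X.TmC)} (hΓ : X.IsCtx Γ) {A : X.TyC}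
    {l : List ℕ} (h : X.DependsOn Γ A l) : l.Nodup ∧ l.length = A.1 := by
  refine DependsOn.induction hΓ (P := fun A l => l.Nodup ∧ l.length = A.1) ?_ ?_ A.1 A.2 l h
  · simp
  · intro n A l x hx ih
    refine ⟨List.Nodup.append ih.1 (List.nodup_singleton x) ?_, by simp [ih.2]⟩
    rw [List.disjoint_singleton]
    exact fun hx' => (hΓ.mem_of_mem_fv hx (Expr.mem_fv_appVars.2 hx')).2 rfl

theorem IsCtx.eq_of_mem {Γ : Ctx (X.TyC ⊕ X.TmC)} (hΓ : X.IsCtx Γ) {x S T}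
    (hS : (x, S) ∈ Γ) (hT : (x, T) ∈ Γ) : S = T := by
  have := List.inj_on_of_nodup_map hΓ.nodup hS hT rfl
  exact congrArg Prod.snd this

/-- The arguments are added one at a time, and the declared type of each, which is unique, has
exactly the preceding ones as its variables. -/
theorem DependsOn.closed {Γ : Ctx (X.TyC ⊕ X.TmC)} (hΓ : X.IsCtx Γ) {A : X.TyC}
    {l : List ℕ} (h : X.DependsOn Γ A l) {x S} (hx : x ∈ l) (hS : (x, S) ∈ Γ) {v : ℕ}
    (hv : v ∈ S.fv) : v ∈ l := by
  refine DependsOn.induction hΓ (P := fun _ l => x ∈ l → v ∈ l) ?_ ?_ A.1 A.2 l h hx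
  · simp
  · intro n A l z hz ih hx
    rcases List.mem_append.1 hx with hx | hx
    · exact List.mem_append_left _ (ih hx)
    · rw [List.mem_singleton] at hx
      subst hx
      rw [hΓ.eq_of_mem hS hz, Expr.mem_fv_appVars] at hv
      exact List.mem_append_left _ hv

/-- Only the last argument is looked up in the context, so any declaration of a variable outside `l`
can be dropped. -/
theorem DependsOn.strengthen {Γ Δ : Ctx (X.TyC ⊕ X.TmC)} {y : ℕ} {U : Expr (X.TyC ⊕ X.TmC)}
    {A : X.TyC} {l : List ℕ} (h : X.DependsOn (Δ ++ (y, U) :: Γ) A l) (hy : y ∉ l) :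
    X.DependsOn (Δ ++ Γ) A l := by
  cases h with
  | root A => exact .root A
  | child A l x h =>
    refine .child A l x ?_
    simp only [List.mem_append, List.mem_cons, Prod.mk.injEq] at h ⊢
    have : x ≠ y := by
      rintro rfl
      simp at hy
    tauto

theorem IsCtx.strengthen {Γ : Ctx (X.TyC ⊕ X.TmC)} {y : ℕ} {U : Expr (X.TyC ⊕ X.TmC)} :
    ∀ {Δ : Ctx (X.TyC ⊕ X.TmC)}, X.IsCtx (Δ ++ (y, U) :: Γ) → y ∉ Δ.fv → X.IsCtx (Δ ++ Γ)
  | [], h, _ => h.1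
  | (x, S) :: Δ, h, hy => by
    refine ⟨h.1.strengthen fun ⟨d, hd, hy'⟩ => hy ⟨d, List.mem_cons_of_mem _ hd, hy'⟩, ?_, ?_⟩
    · intro hx
      obtain ⟨d, hd, e⟩ := List.mem_map.1 hx
      exact h.2.1 (e ▸ List.mem_map_of_mem (subset_weaken Δ Γ _ hd))
    · obtain ⟨A, l, rfl, hA⟩ := h.2.2
      exact ⟨A, l, rfl, hA.strengthen fun hl =>
        hy ⟨_, List.mem_cons_self .., Or.inr (Expr.mem_fv_appVars.2 hl)⟩⟩

theorem IsCtx.of_append {Γ : Ctx (X.TyC ⊕ X.TmC)} :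
    ∀ {Δ : Ctx (X.TyC ⊕ X.TmC)}, X.IsCtx (Δ ++ Γ) → X.IsCtx Γ
  | [], h => h
  | _ :: _, h => IsCtx.of_append h.1

/-- A context all of whose variables occur in `A(l)` is a renaming of the context attached to
`A`. -/
theorem DependsOn.eq_rename_genCtx (f : ℕ → ℕ) : ∀ (n : ℕ) (A : X.Ty n)
    (Γ : Ctx (X.TyC ⊕ X.TmC)), X.IsCtx Γ → X.DependsOn Γ ⟨n, A⟩ ((List.range n).map f) →
    (∀ x ∈ List.map Prod.fst Γ, x ∈ (List.range n).map f) → Γ = (X.genCtx n A).rename f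
  | 0, A, Γ, _, _, hl => by
    cases Γ with
    | nil => rfl
    | cons d Γ => simpa using hl d.1 (List.mem_cons_self ..)
  | n + 1, A, Γ, hΓ, h, hl => by
    generalize e : (List.range (n + 1)).map f = l at h hl
    cases h with
    | child _ l x h =>
      rw [List.range_succ, List.map_append] at e
      obtain ⟨rfl, e⟩ := List.append_inj' e rfl
      obtain rfl : f n = x := by simpa using e
      cases Γ with
      | nil => simp at h
      | cons d Γ =>
        obtain ⟨z, U⟩ := d
        rcases List.mem_cons.1 h with e | h
        -- The last argument is the most recent declaration. The other declared variables differ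
        -- from it, so induction applies to the rest of the context.
        · cases e
          obtain ⟨B, l', e, hB⟩ := hΓ.2.2
          obtain ⟨e', rfl⟩ := Expr.appVars_injective e
          obtain rfl := Sum.inl.inj e'
          have := DependsOn.eq_rename_genCtx f n (X.bd A) Γ hΓ.1 hB fun x hx => by
            rcases List.mem_append.1 (hl x (List.mem_cons_of_mem _ hx)) with h | h
            · exact h
            · rw [List.mem_singleton] at h
              exact absurd (h ▸ hx) hΓ.2.1
          rw [genCtx, Ctx.rename, List.map_cons, Expr.rename_appVars]
          rw [Ctx.rename] at this
          rw [← this]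
        -- The last argument is declared before `z`. As `z` is that argument or occurs in its type,
        -- `z` would be declared twice.
        · exfalso
          have hz := hl z (List.mem_cons_self ..)
          rcases List.mem_append.1 hz with hz | hz
          · exact hΓ.2.1 (hΓ.1.mem_of_mem_fv h (Expr.mem_fv_appVars.2 hz)).1
          · rw [List.mem_singleton] at hz
            exact hΓ.2.1 (hz ▸ List.mem_map_of_mem (f := Prod.fst) h)

/-- Picks the most recent declaration outside `l`: all later ones then declare members of `l`, as is
needed to see that they do not mention `y`. -/
theorem exists_split (l : List ℕ) : ∀ Γ : Ctx (X.TyC ⊕ X.TmC),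
    (∀ x ∈ List.map Prod.fst Γ, x ∈ l) ∨ ∃ Δ y U Γ', Γ = Δ ++ (y, U) :: Γ' ∧ y ∉ l ∧
      ∀ x ∈ List.map Prod.fst Δ, x ∈ l
  | [] => Or.inl (by simp)
  | (z, T) :: Γ => by
    by_cases hz : z ∈ l
    · rcases exists_split l Γ with h | ⟨Δ, y, U, Γ', rfl, hy, hΔ⟩
      · exact Or.inl (by simpa [hz] using h)
      · exact Or.inr ⟨(z, T) :: Δ, y, U, Γ', rfl, hy, by simpa [hz] using hΔ⟩
    · exact Or.inr ⟨[], z, T, Γ, rfl, hz, by simp⟩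

/-- If an assertion `P` is derivable in the context attached to `A`, then each instance of it along
`A(l)` is derivable. -/
theorem DependsOn.derivable : ∀ (N : ℕ) (Γ : Ctx (X.TyC ⊕ X.TmC)), List.length Γ = N → X.IsCtx Γ →
    ∀ (A : X.TyC) (l : List ℕ), X.DependsOn Γ A l →
    ∀ P : List ℕ → Assertion (X.TyC ⊕ X.TmC), (∀ l f, (P l).rename f = P (l.map f)) →
    Derivable X.freeBasic ⟨X.genCtx A.1 A.2, P (List.range A.1)⟩ →
    Derivable X.freeBasic ⟨Γ, P l⟩ := by
  intro N
  -- Both premises of the weakening rule have shorter contexts. One of them concerns the type of the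
  -- removed variable, so the claim must range over all `A`, `l` and `P`.
  induction N using Nat.strong_induction_on with
  | _ N ih =>
  intro Γ hN hΓ A l h P hP hA
  rcases exists_split l Γ with hl | ⟨Δ, y, U, Γ', rfl, hy, hΔ⟩
  -- Every declared variable is an argument: the context is that of the basic judgement up to a
  -- permutation.
  · obtain ⟨hn, hlen⟩ := h.nodup_length hΓ
    obtain ⟨σ, rfl⟩ := exists_perm_map_eq (List.nodup_range (n := A.1)) hn (by simp [hlen])
    have := Derivable.alpha σ hA
    rw [Judgement.rename, hP] at this
    rwa [DependsOn.eq_rename_genCtx σ A.1 A.2 Γ hΓ h hl]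
  -- The declarations after `y` belong to `l`, and by closedness so do the variables of their types;
  -- hence `y` occurs in none of them.
  · have hyΔ : y ∉ Ctx.fv Δ := by
      rintro ⟨⟨x, S⟩, hd, rfl | hS⟩
      · exact hy (hΔ _ (List.mem_map_of_mem (f := Prod.fst) hd))
      · exact hy (h.closed hΓ (hΔ _ (List.mem_map_of_mem (f := Prod.fst) hd))
          (List.mem_append_left _ hd) hS)
    have hΓ' := hΓ.of_append
    have hyΓ : y ∉ Ctx.fv Γ' := by
      rintro ⟨⟨x, S⟩, hd, rfl | hS⟩
      · exact hΓ'.2.1 (List.mem_map_of_mem (f := Prod.fst) hd)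
      · exact hΓ'.2.1 (hΓ'.1.mem_of_mem_fv hd hS).1
    simp only [List.length_append, List.length_cons] at hN
    refine .weaken ?_ ?_ hyΓ hyΔ
    · obtain ⟨B, l', rfl, hB⟩ := hΓ'.2.2
      exact ih (List.length Γ') (by omega) Γ' rfl hΓ'.1 B l' hB
        (fun l => .type (Expr.appVars (.inl B) l))
        (fun l f => by simp only [Assertion.rename, Expr.rename_appVars])
        (derivable_tyAxiom X B.1 B.2)
    · exact ih (Δ.length + Γ'.length) (by omega) _ (by simp) (hΓ.strengthen hyΔ) A l
        (h.strengthen hy) P hP hA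

theorem derivable_type {Γ : Ctx (X.TyC ⊕ X.TmC)} (hΓ : X.IsCtx Γ) {A : X.TyC} {l : List ℕ}
    (h : X.DependsOn Γ A l) : Derivable X.freeBasic ⟨Γ, .type (Expr.appVars (.inl A) l)⟩ :=
  DependsOn.derivable _ Γ rfl hΓ A l h (fun l => .type (Expr.appVars (.inl A) l))
    (fun l f => by simp only [Assertion.rename, Expr.rename_appVars])
    (derivable_tyAxiom X A.1 A.2)

theorem derivable_term {Γ : Ctx (X.TyC ⊕ X.TmC)} (hΓ : X.IsCtx Γ) {a : X.TmC} {l : List ℕ}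
    (h : X.DependsOn Γ ⟨a.1, X.tmBd a.2⟩ l) :
    Derivable X.freeBasic ⟨Γ, .term (Expr.appVars (.inr a) l)
      (Expr.appVars (.inl ⟨a.1, X.tmBd a.2⟩) l)⟩ :=
  DependsOn.derivable _ Γ rfl hΓ _ l h
    (fun l => .term (Expr.appVars (.inr a) l) (Expr.appVars (.inl ⟨a.1, X.tmBd a.2⟩) l))
    (fun l f => by simp only [Assertion.rename, Expr.rename_appVars])
    (derivable_tmAxiom X a)

end TTStruct

/-! ### Contexts with standard variables -/

namespace Ctx

variable {K L : Type u}

/-- The context `0 : e 0, …, n - 1 : e (n - 1)`. -/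
def ofFn (e : ℕ → Expr K) : ℕ → Ctx K
  | 0 => []
  | n + 1 => (n, e n) :: ofFn e n

theorem length_ofFn (e : ℕ → Expr K) : ∀ n, List.length (ofFn e n) = n
  | 0 => rfl
  | n + 1 => congrArg (· + 1) (length_ofFn e n)

theorem mem_ofFn {e : ℕ → Expr K} {x : ℕ} {S : Expr K} :
    ∀ {n : ℕ}, (x, S) ∈ ofFn e n ↔ x < n ∧ S = e x
  | 0 => by simp [ofFn]
  | n + 1 => by
    rw [ofFn, List.mem_cons, mem_ofFn, Prod.mk.injEq, Nat.lt_succ_iff_lt_or_eq]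
    constructor
    · rintro (⟨rfl, rfl⟩ | ⟨h, rfl⟩)
      · exact ⟨Or.inr rfl, rfl⟩
      · exact ⟨Or.inl h, rfl⟩
    · rintro ⟨h | rfl, rfl⟩
      · exact Or.inr ⟨h, rfl⟩
      · exact Or.inl ⟨rfl, rfl⟩

theorem lt_of_mem_vars_ofFn {e : ℕ → Expr K} {n x : ℕ}
    (h : x ∈ List.map Prod.fst (ofFn e n)) : x < n := by
  obtain ⟨⟨y, S⟩, hd, rfl⟩ := List.mem_map.1 h
  exact (mem_ofFn.1 hd).1

theorem mapConst_ofFn (g : K → L) (e : ℕ → Expr K) :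
    ∀ n, (ofFn e n).mapConst g = ofFn (fun k => (e k).mapConst g) n
  | 0 => rfl
  | n + 1 => congrArg (List.cons _) (mapConst_ofFn g e n)

theorem ofFn_congr {e e' : ℕ → Expr K} : ∀ {n : ℕ}, (∀ k < n, e k = e' k) → ofFn e n = ofFn e' n
  | 0, _ => rfl
  | n + 1, h => by
    rw [ofFn, ofFn, h n n.lt_succ_self, ofFn_congr fun k hk => h k (hk.trans n.lt_succ_self)]

/-- The asserted type joins those of the context in one sequence, just as a heap treats it as its
largest element. -/
theorem exists_eq_ofFn : ∀ (n : ℕ) (Γ : Ctx K), Γ.vars = List.range n →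
    ∀ T, ∃ e : ℕ → Expr K, Γ = ofFn e n ∧ T = e n
  | 0, Γ, h, T => by
    refine ⟨fun _ => T, ?_, rfl⟩
    exact List.map_eq_nil_iff.1 (List.reverse_eq_nil_iff.1 h)
  | n + 1, [], h, _ => by simp [vars, List.range_succ] at h
  | n + 1, (x, S) :: Γ, h, T => by
    rw [List.range_succ, vars, List.map_cons, List.reverse_cons] at h
    obtain ⟨h, hx⟩ := List.append_inj' h rfl
    obtain ⟨e, rfl, rfl⟩ := exists_eq_ofFn n Γ h S
    obtain rfl : x = n := by simpa using hx
    refine ⟨fun k => if k = x + 1 then T else e k, ?_, by simp⟩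
    rw [ofFn, if_neg (by omega)]
    exact congrArg _ (ofFn_congr fun k hk => (if_neg (by omega)).symm)

/-- The position of a declared variable. -/
def pos : Ctx K → ℕ → ℕ
  | [], _ => 0
  | (x, _) :: Γ, v => if v = x then List.length Γ else pos Γ v

theorem pos_ofFn (e : ℕ → Expr K) : ∀ {n v : ℕ}, v < n → pos (ofFn e n) v = v
  | n + 1, v, h => by
    rw [ofFn, pos]
    split_ifs with h'
    · rw [length_ofFn, h']
    · exact pos_ofFn e (by omega)

theorem varSubst_mem : ∀ {Γ Δ : Ctx K}, List.length Γ = List.length Δ → ∀ {v : ℕ},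
    v ∈ List.map Prod.fst Δ → varSubst Γ Δ v ∈ List.map Prod.fst Γ
  | [], [], _, v, hv => by simp at hv
  | (x, S) :: Γ, (y, T) :: Δ, h, v, hv => by
    rw [varSubst]
    split_ifs with h'
    · exact List.mem_cons_self ..
    · exact List.mem_cons_of_mem _ (varSubst_mem (by simpa using h)
        ((List.mem_cons.1 hv).resolve_left h'))

/-- The renaming used in `≡` matches variables by position, which is why positions give invariants.
-/
theorem pos_varSubst : ∀ {Γ Δ : Ctx K}, List.length Γ = List.length Δ →
    (List.map Prod.fst Γ).Nodup → ∀ {v : ℕ}, v ∈ List.map Prod.fst Δ →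
    pos Γ (varSubst Γ Δ v) = pos Δ v
  | [], [], _, _, v, hv => by simp at hv
  | (x, S) :: Γ, (y, T) :: Δ, h, hΓ, v, hv => by
    have h1 : List.length Γ = List.length Δ := by simpa using h
    rw [varSubst, pos, pos]
    split_ifs with h' h'' h''
    · exact h1
    · exact absurd rfl h''
    · have := varSubst_mem h1 ((List.mem_cons.1 hv).resolve_left h')
      exact absurd (h'' ▸ this) (List.nodup_cons.1 hΓ).1
    · exact pos_varSubst h1 (List.nodup_cons.1 hΓ).2 ((List.mem_cons.1 hv).resolve_left h')

theorem varSubst_rename (f : ℕ → ℕ) : ∀ {Γ : Ctx K} {v : ℕ}, v ∈ List.map Prod.fst Γ →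
    varSubst (Γ.rename f) Γ v = f v
  | (x, S) :: Γ, v, hv => by
    rw [rename, List.map_cons, varSubst]
    split_ifs with h
    · rw [h]
    · exact varSubst_rename f ((List.mem_cons.1 hv).resolve_left h)

end Ctx

/-! ### Min-heaps and maps from `[φ]` -/

namespace MinHeap

variable {X : TTStruct.{u}} {n : ℕ}

/-- The elements of the branch of `φ` from the root to `i`, with the root left out and numbered
from `0`. -/
def path (φ : MinHeap n) (i : Fin (n + 1)) : List ℕ :=
  if h : i = 0 then [] else
    have := φ.map_lt i h
    path φ (φ.toFun i) ++ [i.val - 1]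
termination_by i

theorem path_zero (φ : MinHeap n) : φ.path 0 = [] := by
  rw [path, dif_pos rfl]

theorem path_of_ne (φ : MinHeap n) {i : Fin (n + 1)} (h : i ≠ 0) :
    φ.path i = φ.path (φ.toFun i) ++ [i.val - 1] := by
  rw [path, dif_neg h]

/-- The last entry of a nonempty branch gives its end, and only the root has an empty branch; so the
two heaps need not agree. -/
theorem path_injective {φ ψ : MinHeap n} {i j : Fin (n + 1)} (h : φ.path i = ψ.path j) :
    i = j := by
  by_cases hi : i = 0 <;> by_cases hj : j = 0
  · rw [hi, hj]
  · subst hi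
    rw [path_zero, path_of_ne ψ hj] at h
    simp at h
  · subst hj
    rw [path_zero, path_of_ne φ hi] at h
    simp at h
  · rw [path_of_ne φ hi, path_of_ne ψ hj] at h
    have := (List.append_inj' h rfl).2
    simp only [List.cons.injEq, and_true] at this
    have := Fin.val_ne_zero_iff.2 hi
    have := Fin.val_ne_zero_iff.2 hj
    exact Fin.ext (by omega)

theorem path_bd (φ : MinHeap (n + 1)) (i : Fin (n + 1)) : φ.path i.castSucc = φ.bd.path i := by
  induction i using WellFoundedLT.induction with
  | _ i ih =>
  by_cases h : i = 0
  · subst h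
    rw [Fin.castSucc_zero, path_zero, path_zero]
  · rw [path_of_ne φ (by simpa using h), path_of_ne _ h, ← ih _ (φ.bd.map_lt i h)]
    rfl

/-- The type-element `h(i)` together with its degree. -/
noncomputable def elt {φ : MinHeap n} (h : shape.{u} φ ⟶ X) (i : Fin (n + 1)) (hi : i ≠ 0) :
    X.TyC :=
  ⟨φ.depth i - 1, TTStruct.mapTy h
    (⟨i, hi, (Nat.sub_add_cancel (φ.depth_pos _)).symm⟩ : ShapeTy.{u} φ (φ.depth i - 1))⟩

/-- Frees the degree from its form `depth - 1`; equality of dependent pairs replaces transport. -/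
theorem elt_eq {φ : MinHeap n} (h : shape.{u} φ ⟶ X) {m : ℕ} (x : ShapeTy.{u} φ m) :
    elt h x.down.1 x.down.2.1 = ⟨m, TTStruct.mapTy h (x : (shape.{u} φ).Ty m)⟩ := by
  obtain ⟨i, hi, hd⟩ := x
  obtain rfl : m = φ.depth i - 1 := by omega
  rfl

theorem elt_root {φ : MinHeap n} (h : shape.{u} φ ⟶ X) {i : Fin (n + 1)} (hi : i ≠ 0)
    (h0 : φ.toFun i = 0) : ∃ A : X.Ty 0, elt h i hi = ⟨0, A⟩ :=
  ⟨_, elt_eq h (⟨i, hi, φ.depth_root h0⟩ : ShapeTy.{u} φ 0)⟩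

theorem elt_child {φ : MinHeap n} (h : shape.{u} φ ⟶ X) {i : Fin (n + 1)} (hi : i ≠ 0)
    (h0 : φ.toFun i ≠ 0) : ∃ (m : ℕ) (A : X.Ty (m + 1)), elt h i hi = ⟨m + 1, A⟩ ∧
      elt h (φ.toFun i) h0 = ⟨m, X.bd A⟩ := by
  have := φ.depth_step h0
  have := φ.depth_pos (φ.toFun i)
  obtain ⟨m, hm⟩ : ∃ m, φ.depth i = m + 1 + 1 := ⟨φ.depth i - 2, by omega⟩
  let x : ShapeTy.{u} φ (m + 1) := ⟨i, hi, hm⟩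
  exact ⟨m, _, elt_eq h x, (elt_eq h (shapeBd φ m x)).trans
    (congrArg (Sigma.mk m) (TTStruct.mapTy_bd h (x : (shape.{u} φ).Ty (m + 1))))⟩

theorem shape_hom_ext {φ : MinHeap n} {h h' : shape.{u} φ ⟶ X}
    (e : ∀ i hi, elt h i hi = elt h' i hi) : h = h' := by
  refine TTStruct.hom_ext (fun m x => ?_) (fun m a => PEmpty.elim a)
  have := e (show ShapeTy.{u} φ m from x).down.1 (show ShapeTy.{u} φ m from x).down.2.1
  rw [elt_eq, elt_eq] at this
  exact eq_of_heq (Sigma.mk.inj this).2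

/-- Degrees need not be prescribed: by induction along `φ`, the two conditions force them to match
the depths. -/
theorem exists_shape_hom (φ : MinHeap n) (a : Fin (n + 1) → X.TyC)
    (root : ∀ i, i ≠ 0 → φ.toFun i = 0 → (a i).1 = 0)
    (child : ∀ i, i ≠ 0 → φ.toFun i ≠ 0 → ∃ (m : ℕ) (A : X.Ty (m + 1)), a i = ⟨m + 1, A⟩ ∧
      a (φ.toFun i) = ⟨m, X.bd A⟩) :
    ∃ h : shape.{u} φ ⟶ X, ∀ i hi, elt h i hi = a i := by
  have hdeg : ∀ i, i ≠ 0 → φ.depth i = (a i).1 + 1 := by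
    intro i
    induction i using WellFoundedLT.induction with
    | _ i ih =>
    intro hi
    by_cases h0 : φ.toFun i = 0
    · rw [φ.depth_root h0, root i hi h0]
    · obtain ⟨m, A, e, e'⟩ := child i hi h0
      rw [φ.depth_step h0, ih _ (φ.map_lt i hi) h0, e, e']
  have hex : ∀ m (x : ShapeTy.{u} φ m), ∃ A : X.Ty m, a x.down.1 = ⟨m, A⟩ := by
    rintro m ⟨i, hi, hd⟩
    obtain rfl : m = (a i).1 := by
      have := hdeg i hi
      omega
    exact ⟨(a i).2, rfl⟩
  choose f hf using hex
  refine ⟨TTStruct.homMk f (fun _ b => PEmpty.elim b) ?_ (fun _ b => PEmpty.elim b), ?_⟩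
  · intro m x
    change f m (shapeBd φ m x) = X.bd (f (m + 1) x)
    have h1 := hf m (shapeBd φ m x)
    have h2 := hf (m + 1) x
    obtain ⟨k, A, e, e'⟩ := child _ (ULift.down x).2.1 (shapeBd φ m x).down.2.1
    obtain ⟨hk, hA⟩ := Sigma.mk.inj (h2.symm.trans e)
    obtain rfl : m = k := by omega
    rw [eq_of_heq hA]
    exact eq_of_heq (Sigma.mk.inj (h1.symm.trans e')).2
  · intro i hi
    exact (hf _ _).symm

end MinHeap

/-! ### The types encoded by a min-heap -/

namespace HeapTy

variable {X Y : TTStruct.{u}} {n : ℕ}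

/-- The type `Tₖ₊₁` in the judgement `x₁ : T₁, …, xₙ : Tₙ ⊢ Tₙ₊₁ type` encoded by `(φ, h)`. -/
noncomputable def expr (p : HeapTy X n) (k : ℕ) : Expr (X.TyC ⊕ X.TmC) :=
  if hk : k < n + 1 then
    Expr.appVars (.inl (MinHeap.elt p.2 (Fin.succ ⟨k, hk⟩) (Fin.succ_ne_zero _)))
      (p.1.path (p.1.toFun (Fin.succ ⟨k, hk⟩)))
  -- Junk value; a variable is unaffected by relabelling of constants, so `expr_map` holds for every
  -- `k`.
  else .var 0

theorem expr_of_lt (p : HeapTy X n) {k : ℕ} (hk : k < n + 1) :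
    p.expr k = Expr.appVars (.inl (MinHeap.elt p.2 (Fin.succ ⟨k, hk⟩) (Fin.succ_ne_zero _)))
      (p.1.path (p.1.toFun (Fin.succ ⟨k, hk⟩))) := dif_pos hk

theorem expr_last (p : HeapTy X n) : p.expr n = Expr.appVars (.inl ⟨p.topDeg, p.top⟩)
    (p.1.path (p.1.toFun (Fin.last (n + 1)))) := p.expr_of_lt n.lt_succ_self

theorem expr_bd (p : HeapTy X (n + 1)) {k : ℕ} (hk : k < n + 1) : p.bd.expr k = p.expr k := by
  rw [expr_of_lt _ hk, expr_of_lt _ (hk.trans n.succ.lt_succ_self)]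
  congr 1
  -- Depths in `∂φ` and `φ` agree only propositionally, so the element is presented as an image
  -- under the inclusion.
  · have := MinHeap.elt_eq p.2 ((TTStruct.mapTy (MinHeap.shapeIncl.{u} p.1)
      (⟨Fin.succ ⟨k, hk⟩, Fin.succ_ne_zero _, (Nat.sub_add_cancel (p.1.bd.depth_pos _)).symm⟩ :
        MinHeap.ShapeTy.{u} p.1.bd (p.1.bd.depth (Fin.succ ⟨k, hk⟩) - 1)) :
          (MinHeap.shape.{u} p.1).Ty _) : MinHeap.ShapeTy.{u} p.1 _)
    exact congrArg Sum.inl this.symm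
  · exact (p.1.path_bd _).symm

theorem expr_map (f : X ⟶ Y) (p : HeapTy X n) (k : ℕ) :
    (p.map f).expr k = (p.expr k).mapConst (TTStruct.mapC f) := by
  by_cases hk : k < n + 1
  · rw [expr_of_lt _ hk, expr_of_lt _ hk, Expr.mapConst_appVars]
    rfl
  · rw [expr, dif_neg hk, expr, dif_neg hk]
    rfl

/-- The constant gives the value of `h`, and the argument list is a branch whose end is the parent.
-/
theorem expr_injective {p q : HeapTy X n} (h : ∀ k < n + 1, p.expr k = q.expr k) : p = q := by
  have key : ∀ i : Fin (n + 2), ∀ hi : i ≠ 0, p.1.toFun i = q.1.toFun i ∧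
      MinHeap.elt p.2 i hi = MinHeap.elt q.2 i hi := by
    intro i hi
    obtain ⟨⟨k, hk⟩, rfl⟩ := Fin.exists_succ_eq.2 hi
    have := h k hk
    rw [expr_of_lt _ hk, expr_of_lt _ hk] at this
    obtain ⟨e, e'⟩ := Expr.appVars_injective this
    exact ⟨MinHeap.path_injective e', Sum.inl.inj e⟩
  obtain ⟨φ, f⟩ := p
  obtain ⟨ψ, g⟩ := q
  obtain rfl : φ = ψ := by
    refine MinHeap.ext (funext fun i => ?_)
    by_cases hi : i = 0
    · rw [hi, φ.map_zero, ψ.map_zero]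
    · exact (key i hi).1
  exact congrArg (Sigma.mk φ) (MinHeap.shape_hom_ext fun i hi => (key i hi).2)

/-- A parent `j ≠ 0` corresponds to the variable `j - 1`, whose type carries `h(j) = ∂h(k + 1)`
because `h` commutes with boundaries. -/
theorem dependsOn_ofFn (p : HeapTy X n) {k : ℕ} (hk : k < n + 1) :
    X.DependsOn (Ctx.ofFn p.expr k) (MinHeap.elt p.2 (Fin.succ ⟨k, hk⟩) (Fin.succ_ne_zero _))
      (p.1.path (p.1.toFun (Fin.succ ⟨k, hk⟩))) := by
  by_cases h0 : p.1.toFun (Fin.succ ⟨k, hk⟩) = 0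
  · obtain ⟨A, e⟩ := MinHeap.elt_root p.2 (Fin.succ_ne_zero _) h0
    rw [e, h0, MinHeap.path_zero]
    exact .root A
  · obtain ⟨m, A, e, e'⟩ := MinHeap.elt_child p.2 (Fin.succ_ne_zero _) h0
    have hlt := p.1.map_lt _ (Fin.succ_ne_zero ⟨k, hk⟩)
    rw [e, MinHeap.path_of_ne _ h0]
    generalize p.1.toFun (Fin.succ ⟨k, hk⟩) = j at h0 e' hlt
    obtain ⟨⟨x, hx⟩, rfl⟩ := Fin.exists_succ_eq.2 h0
    refine .child A _ _ (Ctx.mem_ofFn.2 ⟨?_, ?_⟩)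
    · simpa using hlt
    · rw [← e']
      exact (p.expr_of_lt hx).symm

theorem isType_expr (p : HeapTy X n) {k : ℕ} (hk : k < n + 1) :
    X.IsType (Ctx.ofFn p.expr k) (p.expr k) :=
  ⟨_, _, p.expr_of_lt hk, p.dependsOn_ofFn hk⟩

end HeapTy

/-! ### Reading a min-heap off a judgement -/

namespace TTStruct

variable {X : TTStruct.{u}}

theorem isCtx_ofFn {e : ℕ → Expr (X.TyC ⊕ X.TmC)} : ∀ {n : ℕ},
    X.IsCtx (Ctx.ofFn e n) ↔ ∀ k < n, X.IsType (Ctx.ofFn e k) (e k)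
  | 0 => ⟨fun _ k hk => absurd hk k.not_lt_zero, fun _ => trivial⟩
  | n + 1 => by
    constructor
    · intro h k hk
      rcases Nat.lt_succ_iff_lt_or_eq.1 hk with hk | rfl
      · exact isCtx_ofFn.1 h.1 k hk
      · exact h.2.2
    · intro h
      exact ⟨isCtx_ofFn.2 fun k hk => h k (hk.trans n.lt_succ_self),
        fun hn => lt_irrefl n (Ctx.lt_of_mem_vars_ofFn hn), h n n.lt_succ_self⟩

/-- Every derivable type judgement with standard variables is encoded by some `(φ, h)`. -/
theorem exists_heapTy {n : ℕ} {e : ℕ → Expr (X.TyC ⊕ X.TmC)}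
    (he : ∀ k < n + 1, X.IsType (Ctx.ofFn e k) (e k)) :
    ∃ p : HeapTy X n, ∀ k < n + 1, p.expr k = e k := by
  -- The parent `j` is the last argument plus one, or `0` if there are no arguments; `j ≤ k` is the
  -- heap condition for the element `k + 1`.
  have h1 : ∀ k : Fin (n + 1), ∃ (A : X.TyC) (l : List ℕ) (j : Fin (n + 2)),
      e k = Expr.appVars (.inl A) l ∧ j.val ≤ k.val ∧ ((j = 0 ∧ l = [] ∧ A.1 = 0) ∨
        ∃ (x : Fin (n + 1)) (m : ℕ) (B : X.Ty (m + 1)) (l' : List ℕ), j = x.succ ∧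
          A = ⟨m + 1, B⟩ ∧ l = l' ++ [x.val] ∧ e x = Expr.appVars (.inl ⟨m, X.bd B⟩) l') := by
    intro k
    obtain ⟨A, l, h, hA⟩ := he k k.2
    cases hA with
    | root A => exact ⟨_, _, 0, h, Nat.zero_le _, Or.inl ⟨rfl, rfl, rfl⟩⟩
    | child A l x hx =>
      obtain ⟨hx, hx'⟩ := Ctx.mem_ofFn.1 hx
      exact ⟨_, _, Fin.succ ⟨x, hx.trans k.2⟩, h, hx, Or.inr ⟨_, _, A, l, rfl, rfl, rfl, hx'.symm⟩⟩
  choose A l j hA hj hs using h1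
  let φ : MinHeap (n + 1) :=
    { toFun := Fin.cases 0 j
      map_zero := rfl
      map_lt := fun i hi => by
        obtain ⟨k, rfl⟩ := Fin.exists_succ_eq.2 hi
        rw [Fin.cases_succ, Fin.lt_def, Fin.val_succ]
        exact Nat.lt_succ_of_le (hj k) }
  -- The arguments before the last are those of the type of the last one, so induction identifies
  -- the whole list with a branch.
  have hl : ∀ k, l k = φ.path (φ.toFun k.succ) := by
    intro k
    induction k using WellFoundedLT.induction with
    | _ k ih =>
    change l k = φ.path (j k)
    rcases hs k with ⟨h0, h0', -⟩ | ⟨x, m, B, l', hx, -, hl, hx'⟩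
    · rw [h0, h0', MinHeap.path_zero]
    · have hlt : x < k := by
        have := hj k
        rw [hx, Fin.val_succ] at this
        exact this
      rw [hx, MinHeap.path_of_ne _ (Fin.succ_ne_zero x), ← ih x hlt, hl,
        (Expr.appVars_injective ((hA x).symm.trans hx')).2]
      rfl
  -- The value `A 0` at the root is a filler, on which no condition bears.
  obtain ⟨h, hh⟩ := MinHeap.exists_shape_hom φ (Fin.cases (A 0) A) (by
    intro i hi h0
    obtain ⟨k, rfl⟩ := Fin.exists_succ_eq.2 hi
    rcases hs k with ⟨-, -, h⟩ | ⟨x, m, B, l', hx, -⟩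
    · exact h
    · exact absurd (hx.symm.trans h0) (Fin.succ_ne_zero x)) (by
    intro i hi h0
    obtain ⟨k, rfl⟩ := Fin.exists_succ_eq.2 hi
    rcases hs k with ⟨h, -⟩ | ⟨x, m, B, l', hx, hB, -, hx'⟩
    · exact absurd h h0
    · refine ⟨m, B, hB, ?_⟩
      change Fin.cases (motive := fun _ => X.TyC) (A 0) A (j k) = _
      rw [hx]
      exact Sum.inl.inj (Expr.appVars_injective ((hA x).symm.trans hx')).1)
  refine ⟨⟨φ, h⟩, fun k hk => ?_⟩
  rw [HeapTy.expr_of_lt _ hk, hA ⟨k, hk⟩, hl]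
  exact congrArg (fun B : X.TyC => Expr.appVars (Sum.inl B) _) (hh _ _)

end TTStruct

/-! ### Invariants of judgements -/

namespace Ctx

variable {K : Type u}

/-- The types `Tₙ, …, T₁` of a judgement `x₁ : T₁, …, xₙ₋₁ : Tₙ₋₁ ⊢ Tₙ type`, where each variable is
replaced by its position. -/
def standardize : Ctx K → Expr K → List (Expr K)
  | [], T => [T.rename (pos ([] : Ctx K))]
  | (x, S) :: Γ, T => T.rename (pos ((x, S) :: Γ)) :: standardize Γ S

theorem rename_pos_ofFn {e : ℕ → Expr K} {n : ℕ} {T : Expr K} (h : ∀ v ∈ T.fv, v < n) :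
    T.rename (pos (ofFn e n)) = T :=
  (Expr.rename_congr fun v hv => pos_ofFn e (h v hv)).trans (Expr.rename_id T)

theorem standardize_ofFn {e : ℕ → Expr K} : ∀ {n : ℕ}, (∀ k < n + 1, ∀ v ∈ (e k).fv, v < k) →
    standardize (ofFn e n) (e n) = List.map Prod.snd (ofFn e (n + 1))
  | 0, h => congrArg (fun T => [T]) (rename_pos_ofFn (e := e) (n := 0) (h 0 Nat.one_pos))
  | n + 1, h => by
    have ih := standardize_ofFn fun k hk => h k (hk.trans (Nat.lt_succ_self _))
    have := rename_pos_ofFn (e := e) (h (n + 1) (Nat.lt_succ_self _))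
    rw [ofFn] at this ⊢
    rw [standardize, ih, this]
    rfl

theorem eq_of_map_snd_ofFn_eq {e e' : ℕ → Expr K} : ∀ {n : ℕ},
    List.map Prod.snd (ofFn e n) = List.map Prod.snd (ofFn e' n) → ∀ k < n, e k = e' k
  | n + 1, h, k, hk => by
    obtain ⟨h1, h2⟩ := List.cons.inj h
    rcases Nat.lt_succ_iff_lt_or_eq.1 hk with hk | rfl
    · exact eq_of_map_snd_ofFn_eq h2 k hk
    · exact h1

end Ctx

/-! ### Invariance under `≡` and normal forms -/

namespace TTStruct

variable {X : TTStruct.{u}}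

theorem IsType.derivable {Γ : Ctx (X.TyC ⊕ X.TmC)} (hΓ : X.IsCtx Γ)
    {T : Expr (X.TyC ⊕ X.TmC)} (h : X.IsType Γ T) : Derivable X.freeBasic ⟨Γ, .type T⟩ := by
  obtain ⟨A, l, rfl, h⟩ := h
  exact derivable_type hΓ h

theorem IsType.fv_subset {Γ : Ctx (X.TyC ⊕ X.TmC)} (hΓ : X.IsCtx Γ)
    {T : Expr (X.TyC ⊕ X.TmC)} (h : X.IsType Γ T) {v : ℕ} (hv : v ∈ T.fv) :
    v ∈ List.map Prod.fst Γ := by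
  obtain ⟨A, l, rfl, h⟩ := h
  exact h.mem hΓ (Expr.mem_fv_appVars.1 hv)

theorem IsTerm.fv_subset {Γ : Ctx (X.TyC ⊕ X.TmC)} (hΓ : X.IsCtx Γ)
    {t T : Expr (X.TyC ⊕ X.TmC)} (h : X.IsTerm Γ t T) {v : ℕ} (hv : v ∈ t.fv) :
    v ∈ List.map Prod.fst Γ := by
  obtain ⟨a, l, rfl, -, h⟩ := h
  exact h.mem hΓ (Expr.mem_fv_appVars.1 hv)

/-- As derived equality is syntactic, `≡` only exchanges variables in equal positions. -/
theorem typeCong_standardize : ∀ {Γ Δ : Ctx (X.TyC ⊕ X.TmC)} {S T : Expr (X.TyC ⊕ X.TmC)},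
    X.IsCtx Γ → X.IsCtx Δ → X.IsType Δ T → TypeCong X.freeBasic Γ S Δ T →
    List.length Γ = List.length Δ ∧ Γ.standardize S = Δ.standardize T
  | [], [], S, T, _, _, _, h => by
    rw [(holds_of_derivable h).2.1]
    exact ⟨rfl, rfl⟩
  | (x, S') :: Γ, (y, T') :: Δ, S, T, hΓ, hΔ, hT, h => by
    obtain ⟨h1, h2⟩ := typeCong_standardize hΓ.1 hΔ.1 hΔ.2.2 h.1
    have hlen : List.length ((x, S') :: Γ) = List.length ((y, T') :: Δ) := congrArg (· + 1) h1
    refine ⟨hlen, ?_⟩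
    rw [(holds_of_derivable h.2).2.1]
    rw [Ctx.standardize, Ctx.standardize, h2]
    congr 1
    rw [Expr.rename_rename]
    exact Expr.rename_congr fun v hv => Ctx.pos_varSubst hlen hΓ.nodup (hT.fv_subset hΔ hv)
  | [], _ :: _, _, _, _, _, _, h => h.elim
  | _ :: _, [], _, _, _, _, _, h => h.elim

theorem rename_pos_eq_of_tmRel {n : ℕ} {J J' : TmJ X.freeBasic n}
    (h : tmRel X.freeBasic n J J') :
    J.tm.rename (Ctx.pos J.ctx) = J'.tm.rename (Ctx.pos J'.ctx) := by
  have hJ := holds_of_derivable J.derivable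
  have hJ' := holds_of_derivable J'.derivable
  rw [(holds_of_derivable h.2).2.1, Expr.rename_rename]
  exact Expr.rename_congr fun v hv => Ctx.pos_varSubst
    (J.length_ctx.trans J'.length_ctx.symm) hJ.1.nodup (IsTerm.fv_subset hJ'.1 hJ'.2 hv)

/-- On the variables which occur, the renaming in `≡` is `σ` itself, so each required equality is an
instance of reflexivity. -/
theorem typeCong_rename (σ : Equiv.Perm ℕ) : ∀ {Γ : Ctx (X.TyC ⊕ X.TmC)}
    {S : Expr (X.TyC ⊕ X.TmC)}, X.IsCtx Γ → X.IsType Γ S →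
    TypeCong X.freeBasic (Γ.rename σ) (S.rename σ) Γ S
  | [], S, hΓ, hS => by
    have : S.rename σ = S := by
      conv_rhs => rw [← Expr.rename_id S]
      exact Expr.rename_congr fun v hv => absurd (hS.fv_subset hΓ hv) List.not_mem_nil
    rw [this]
    exact .typeRefl (hS.derivable hΓ)
  | (x, S') :: Γ, S, hΓ, hS => by
    refine ⟨typeCong_rename σ hΓ.1 hΓ.2.2, ?_⟩
    have : S.rename (Ctx.varSubst (Ctx.rename σ ((x, S') :: Γ)) ((x, S') :: Γ)) = S.rename σ :=
      Expr.rename_congr fun v hv => Ctx.varSubst_rename σ (hS.fv_subset hΓ hv)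
    have h : Derivable X.freeBasic ⟨Ctx.rename σ ((x, S') :: Γ),
      .typeEq (S.rename σ) (S.rename σ)⟩ := .typeRefl (.alpha σ (hS.derivable hΓ))
    nth_rw 2 [← this] at h
    exact h

theorem exists_rename_eq {Γ : Ctx (X.TyC ⊕ X.TmC)} {T : Expr (X.TyC ⊕ X.TmC)}
    (hΓ : X.IsCtx Γ) (hT : X.IsType Γ T) {n : ℕ} (hn : List.length Γ = n) :
    ∃ (σ : Equiv.Perm ℕ) (p : HeapTy X n),
      Γ.rename σ = Ctx.ofFn p.expr n ∧ T.rename σ = p.expr n := by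
  -- Contexts are stored with the last declaration first, hence the reversal.
  obtain ⟨σ, hσ⟩ := exists_perm_map_eq (List.nodup_reverse.2 hΓ.nodup)
    (List.nodup_range (n := n)) (by simp [hn])
  have hv : (Γ.rename σ).vars = List.range n := by
    rw [← hσ, Ctx.vars, Ctx.rename, List.map_map, List.map_reverse, List.map_map]
    rfl
  obtain ⟨e, h1, h2⟩ := Ctx.exists_eq_ofFn n _ hv (T.rename σ)
  have hΓ' := hΓ.rename σ.injective
  have hT' := hT.rename σ
  rw [h1] at hΓ'
  rw [h1, h2] at hT'
  obtain ⟨p, hp⟩ := exists_heapTy (X := X) (n := n) (e := e) fun k hk => by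
    rcases Nat.lt_succ_iff_lt_or_eq.1 hk with hk | rfl
    · exact isCtx_ofFn.1 hΓ' k hk
    · exact hT'
  refine ⟨σ, p, ?_, ?_⟩
  · rw [h1]
    exact Ctx.ofFn_congr fun k hk => (hp k (hk.trans n.lt_succ_self)).symm
  · rw [h2, hp n n.lt_succ_self]

/-- Moves a term-element along an equality of boundaries whose degrees agree only propositionally.
-/
theorem exists_tm {m k : ℕ} {a : X.TmEl m} {B : X.Ty k}
    (h : (⟨m, X.tmBd a⟩ : X.TyC) = ⟨k, B⟩) :
    ∃ b : X.Tm B, (⟨m, a⟩ : X.TmC) = ⟨k, b.1⟩ := by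
  cases h
  exact ⟨⟨a, rfl⟩, rfl⟩

end TTStruct

/-! ### The judgements encoded by min-heaps -/

namespace HeapTy

variable {X Y : TTStruct.{u}} {n : ℕ}

theorem isCtx_ofFn (p : HeapTy X n) : X.IsCtx (Ctx.ofFn p.expr n) :=
  TTStruct.isCtx_ofFn.2 fun _ hk => p.isType_expr (hk.trans n.lt_succ_self)

/-- The type judgement encoded by `(φ, h)`. -/
noncomputable def judgement (p : HeapTy X n) : TyJ X.freeBasic n where
  ctx := Ctx.ofFn p.expr n
  ty := p.expr n
  length_ctx := Ctx.length_ofFn _ _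
  derivable := (p.isType_expr n.lt_succ_self).derivable p.isCtx_ofFn

/-- The list of arguments of the type asserted by `p.judgement`. -/
def args (p : HeapTy X n) : List ℕ := p.1.path (p.1.toFun (Fin.last (n + 1)))

/-- The term judgement encoded by `(φ, h)` and a term-element of `h(n)`. -/
noncomputable def termJudgement (p : HeapTy X n) (a : X.Tm p.top) : TmJ X.freeBasic n where
  ctx := Ctx.ofFn p.expr n
  tm := Expr.appVars (.inr ⟨p.topDeg, a.1⟩) p.args
  ty := p.expr n
  length_ctx := Ctx.length_ofFn _ _
  derivable := by
    have h : X.DependsOn (Ctx.ofFn p.expr n) ⟨p.topDeg, p.top⟩ p.args :=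
      p.dependsOn_ofFn n.lt_succ_self
    -- The basic judgement for `a` is stated with `∂a` in place of `p.top`.
    rw [← a.2] at h
    have := TTStruct.derivable_term (a := ⟨p.topDeg, a.1⟩) p.isCtx_ofFn h
    simp only [a.2] at this
    rw [expr_last]
    exact this

/-- The type-element of `WX` encoded by `(φ, h)`. -/
noncomputable def toTy (p : HeapTy X n) : (weakeningFunctor.obj X).Ty n :=
  Quot.mk (tyRel X.freeBasic n) p.judgement

/-- The term-element of `WX` encoded by `(φ, h)` and a term-element of `h(n)`. -/
noncomputable def toTm (p : HeapTy X n) (a : X.Tm p.top) :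
    (weakeningFunctor.obj X).Tm p.toTy :=
  ⟨Quot.mk (tmRel X.freeBasic n) (p.termJudgement a), rfl⟩

theorem fv_expr (p : HeapTy X n) : ∀ k < n + 1, ∀ v ∈ (p.expr k).fv, v < k := fun _ hk _ hv =>
  Ctx.lt_of_mem_vars_ofFn ((p.isType_expr hk).fv_subset
    (TTStruct.isCtx_ofFn.2 fun _ hj => p.isType_expr (hj.trans hk)) hv)

/-- `standardize` descends to classes, and on a normal form it returns the list of types, which
determines `(φ, h)`. -/
theorem toTy_injective : Function.Injective (toTy (X := X) (n := n)) := by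
  intro p q h
  have := congrArg (Quot.lift (fun J : TyJ X.freeBasic n => J.ctx.standardize J.ty)
    fun J J' h => (TTStruct.typeCong_standardize
      (TTStruct.holds_of_derivable J.derivable).1 (TTStruct.holds_of_derivable J'.derivable).1
      (TTStruct.holds_of_derivable J'.derivable).2 h).2) h
  change Ctx.standardize (Ctx.ofFn p.expr n) (p.expr n) =
    Ctx.standardize (Ctx.ofFn q.expr n) (q.expr n) at this
  rw [Ctx.standardize_ofFn p.fv_expr, Ctx.standardize_ofFn q.fv_expr] at this
  exact expr_injective (Ctx.eq_of_map_snd_ofFn_eq this)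

theorem exists_typeCong {Γ : Ctx (X.TyC ⊕ X.TmC)} {T : Expr (X.TyC ⊕ X.TmC)}
    (hΓ : X.IsCtx Γ) (hT : X.IsType Γ T) (hn : List.length Γ = n) :
    ∃ (σ : Equiv.Perm ℕ) (p : HeapTy X n), Γ.rename σ = Ctx.ofFn p.expr n ∧
      T.rename σ = p.expr n ∧ TypeCong X.freeBasic (Ctx.ofFn p.expr n) (p.expr n) Γ T := by
  obtain ⟨σ, p, h1, h2⟩ := TTStruct.exists_rename_eq hΓ hT hn
  refine ⟨σ, p, h1, h2, ?_⟩
  rw [← h1, ← h2]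
  exact TTStruct.typeCong_rename σ hΓ hT

theorem toTy_surjective : Function.Surjective (toTy (X := X) (n := n)) := by
  intro A
  obtain ⟨J, rfl⟩ := Quot.exists_rep (r := tyRel X.freeBasic n) A
  obtain ⟨hΓ, hT⟩ := TTStruct.holds_of_derivable J.derivable
  obtain ⟨σ, p, -, -, h⟩ := exists_typeCong hΓ hT J.length_ctx
  exact ⟨p, Quot.sound h⟩

theorem toTy_bijective : Function.Bijective (toTy (X := X) (n := n)) :=
  ⟨toTy_injective, toTy_surjective⟩

theorem args_lt (p : HeapTy X n) {v : ℕ} (hv : v ∈ p.args) : v < n :=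
  p.fv_expr n n.lt_succ_self v (by rw [expr_last]; exact Expr.mem_fv_appVars.2 hv)

/-- Replacing variables by positions is invariant under `≡` and fixes the normal form, whose
constant is the term-element. -/
theorem toTm_injective (p : HeapTy X n) : Function.Injective p.toTm := by
  intro a b h
  have := congrArg (Quot.lift (fun J : TmJ X.freeBasic n => J.tm.rename (Ctx.pos J.ctx))
    fun J J' h => TTStruct.rename_pos_eq_of_tmRel h) (congrArg Subtype.val h)
  change (Expr.appVars _ p.args).rename (Ctx.pos (Ctx.ofFn p.expr n)) =
    (Expr.appVars _ p.args).rename (Ctx.pos (Ctx.ofFn p.expr n)) at this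
  rw [Ctx.rename_pos_ofFn fun v hv => p.args_lt (Expr.mem_fv_appVars.1 hv),
    Ctx.rename_pos_ofFn fun v hv => p.args_lt (Expr.mem_fv_appVars.1 hv)] at this
  have := Sum.inr.inj (Expr.appVars_injective this).1
  exact Subtype.ext (eq_of_heq (Sigma.mk.inj this).2)

theorem toTm_surjective (p : HeapTy X n) : Function.Surjective p.toTm := by
  rintro ⟨A, hA⟩
  obtain ⟨J, rfl⟩ := Quot.exists_rep (r := tmRel X.freeBasic n) A
  obtain ⟨Γ, t, T, hn, hJ⟩ := J
  obtain ⟨hΓ, ⟨m, a⟩, l, rfl, rfl, hl⟩ := TTStruct.holds_of_derivable hJ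
  obtain ⟨σ, q, h1, h2, h3⟩ := exists_typeCong hΓ ⟨_, _, rfl, hl⟩ hn
  -- The boundary of the class is `p.toTy`, so the normal form found for it can only be that of `p`.
  obtain rfl : q = p := toTy_injective (Eq.trans (Quot.sound
    (show tyRel X.freeBasic n q.judgement (TmJ.bd ⟨Γ, _, _, hn, hJ⟩) from h3)) hA)
  rw [Expr.rename_appVars, expr_last] at h2
  obtain ⟨e, e'⟩ := Expr.appVars_injective h2
  obtain ⟨b, hb⟩ := TTStruct.exists_tm (Sum.inl.inj e)
  refine ⟨b, Subtype.ext (Quot.sound ⟨h3, ?_⟩)⟩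
  have : (Expr.appVars (Sum.inr ⟨m, a⟩ : X.TyC ⊕ X.TmC) l).rename
      (Ctx.varSubst (Ctx.ofFn q.expr n) Γ) = Expr.appVars (.inr ⟨q.topDeg, b.1⟩) q.args := by
    rw [← h1, Expr.rename_congr fun v hv => Ctx.varSubst_rename σ
      (hl.mem hΓ (Expr.mem_fv_appVars.1 hv)), Expr.rename_appVars, e', hb]
    rfl
  have h : Derivable X.freeBasic ⟨Ctx.ofFn q.expr n, .termEq (Expr.appVars (.inr ⟨q.topDeg, b.1⟩)
      q.args) (Expr.appVars (.inr ⟨q.topDeg, b.1⟩) q.args) (q.expr n)⟩ :=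
    .termRefl (q.termJudgement b).derivable
  nth_rw 2 [← this] at h
  exact h

theorem toTm_bijective (p : HeapTy X n) : Function.Bijective p.toTm :=
  ⟨p.toTm_injective, p.toTm_surjective⟩

theorem bd_toTy (p : HeapTy X (n + 1)) : (weakeningFunctor.obj X).bd p.toTy = p.bd.toTy :=
  congrArg (Quot.mk (tyRel X.freeBasic n)) (TyJ.ext
    (Ctx.ofFn_congr fun _ hk => (p.expr_bd (hk.trans n.lt_succ_self)).symm)
    (p.expr_bd n.lt_succ_self).symm)

theorem ctx_map (f : X ⟶ Y) (p : HeapTy X n) :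
    (Ctx.ofFn p.expr n).mapConst (TTStruct.mapC f) = Ctx.ofFn (p.map f).expr n := by
  rw [Ctx.mapConst_ofFn]
  exact Ctx.ofFn_congr fun k _ => (p.expr_map f k).symm

theorem map_toTy (f : X ⟶ Y) (p : HeapTy X n) :
    TTStruct.mapTy (weakeningFunctor.map f) p.toTy = (p.map f).toTy :=
  congrArg (Quot.mk (tyRel Y.freeBasic n)) (TyJ.ext (p.ctx_map f) (p.expr_map f n).symm)

theorem map_toTm (f : X ⟶ Y) (p : HeapTy X n) (a : X.Tm p.top) :
    TTStruct.mapTmEl (weakeningFunctor.map f) (p.toTm a).1 =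
      ((p.map f).toTm (TTStruct.mapTm f a)).1 :=
  congrArg (Quot.mk (tmRel Y.freeBasic n)) (TmJ.ext (p.ctx_map f) rfl (p.expr_map f n).symm)

end HeapTy

/-! ### The bijections and their naturality -/

theorem mainTheorem7 :
    ∃ (θ : ∀ (X : TTStruct.{u}) (n : ℕ), (weakeningFunctor.obj X).Ty n ≃ HeapTy X n)
      (τ : ∀ (X : TTStruct.{u}) (n : ℕ) (p : HeapTy X n),
        (weakeningFunctor.obj X).Tm ((θ X n).symm p) ≃ X.Tm p.top),
      (∀ (X : TTStruct.{u}) (n : ℕ) (A : (weakeningFunctor.obj X).Ty (n + 1)),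
        θ X n ((weakeningFunctor.obj X).bd A) = (θ X (n + 1) A).bd) ∧
      (∀ (X Y : TTStruct.{u}) (f : X ⟶ Y) (n : ℕ) (A : (weakeningFunctor.obj X).Ty n),
        θ Y n (TTStruct.mapTy (weakeningFunctor.map f) A) = (θ X n A).map f) ∧
      (∀ (X Y : TTStruct.{u}) (f : X ⟶ Y) (n : ℕ) (p : HeapTy X n) (a : X.Tm p.top),
        TTStruct.mapTmEl (weakeningFunctor.map f) ((τ X n p).symm a).1 =
          ((τ Y n (p.map f)).symm (TTStruct.mapTm f a)).1) := by

  -- With `θ` the inverse of `toTy`, `(θ X n).symm p` unfolds to `p.toTy`, so `τ` needs no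
  -- transport.
  refine ⟨fun X n => (Equiv.ofBijective _ HeapTy.toTy_bijective).symm,
    fun X n p => (Equiv.ofBijective _ p.toTm_bijective).symm, ?_, ?_, ?_⟩
  · intro X n A
    obtain ⟨p, rfl⟩ := HeapTy.toTy_surjective A
    rw [Equiv.symm_apply_eq, HeapTy.bd_toTy]
    exact congrArg (fun q => HeapTy.toTy (HeapTy.bd q))
      (Equiv.ofBijective_symm_apply_apply _ HeapTy.toTy_bijective p).symm
  · intro X Y f n A
    obtain ⟨p, rfl⟩ := HeapTy.toTy_surjective A
    rw [Equiv.symm_apply_eq, HeapTy.map_toTy]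
    exact congrArg (fun q => HeapTy.toTy (HeapTy.map f q))
      (Equiv.ofBijective_symm_apply_apply _ HeapTy.toTy_bijective p).symm
  · intro X Y f n p a
    exact HeapTy.map_toTm f p a
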